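/- Let $N\ge 1$, $L>0$, and let $\mathbf c:[0,L]\to\mathbb R^{N+1}$ be a closed rectifiable curve of length $L$ parameterized by arc length, with $\mathbf c(0)=\mathbf c(L)$. An inscribed closed polygonal $P$ is given by a partition $0=t_0<t_1<\dots<t_n=L$ such that the edges $\mathbf v_i=\mathbf c(t_i)-\mathbf c(t_{i-1})$ have lengths $\ell_i=\|\mathbf v_i\|>0$; indices of edges are read cyclically, $\mathbf v_{n+1}=\mathbf v_1$, $\ell_{n+1}=\ell_1$. Its modulus $\mu_{\mathbf c}(P)$ is the maximum of the diameters of the arcs $\mathbf c([t_{i-1},t_i])$. Let $\theta_i\in[0,\pi]$ be the turning angle between $\mathbf v_i$ and $\mathbf v_{i+1}$ at the vertex $\mathbf c(t_i)$, $i=1,\dots,n$ (so the angle at the base point $\mathbf c(t_n)=\mathbf c(t_0)$ is included), and $r_i=\min\{\ell_i,\ell_{i+1}\}$. If all $\theta_i<\pi$, let $\gamma(P)$ be the closed piecewise smooth curve obtained from $P$ by replacing, for every $i=1,\dots,n$, the corner at $\mathbf c(t_i)$ between the two points of the adjacent edges at distance $r_i/2$ from $\mathbf c(t_i)$ by the circular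 arc of opening angle $\theta_i$ that joins these two points and is tangent there to $\mathbf v_i$ and $\mathbf v_{i+1}$, respectively (by the segment if $\theta_i=0$). For $p>1$, the $p$-rotation $\mathbf k_p(P)$ is the integral with respect to arc length of the $p$-th power of the scalar curvature of $\gamma(P)$; if some $\theta_i=\pi$, then $\mathbf k_p(P)=+\infty$. The $p$-curvature of $\mathbf c$ is $$\mathcal F_p(\mathbf c)=\inf\Bigl\{\liminf_{h\to\infty}\mathbf k_p(P_h)\ \Big|\ (P_h)\text{ inscribed closed polygonals in }\mathbf c,\ \mu_{\mathbf c}(P_h)\to0\Bigr\}\in[0,+\infty].$$ Then for every $p>1$ $$\mathcal F_p(\mathbf c)<\infty\iff \mathbf c\in W^{2,p}((0,L),\mathbb R^{N+1})\ \text{ and }\ \dot{\mathbf c}(0)=\dot{\mathbf c}(L),$$ where $\dot{\mathbf c}(0)$, $\dot{\mathbf c}(L)$ are the one-sided derivatives of $\mathbf c$ at the end points of $[0,L]$, and in that case $$\mathcal F_p(\mathbf c)=\int_0^L\|\ddot{\mathbf c}(s)\|^p\,ds ,$$ where $\ddot{\mathbf c}$ is the weak second derivative of $\mathbf c$. -/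

import Mathlib

open Set Filter Topology MeasureTheory
open scoped ENNReal NNReal

noncomputable section

namespace ElasticCurve

section Sobolev

variable {E : Type*} [NormedAddCommGroup E] [NormedSpace ℝ E]

/-- `g` is a weak (distributional) derivative of `u` in the open interval `(a, b)`: both are locally
integrable there and `∫ φ' u = - ∫ φ g` for all test functions `φ ∈ C_c^∞(a, b)`. -/
def IsWeakDeriv (a b : ℝ) (u g : ℝ → E) : Prop :=
  LocallyIntegrableOn u (Ioo a b) volume ∧ LocallyIntegrableOn g (Ioo a b) volume ∧
    ∀ φ : ℝ → ℝ, ContDiff ℝ ((⊤ : ℕ∞) : WithTop ℕ∞) φ → HasCompactSupport φ → tsupport φ ⊆ Ioo a b →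
      ∫ s in Ioo a b, deriv φ s • u s = - ∫ s in Ioo a b, φ s • g s

/-- Membership in the Sobolev space `W^{2,p}((a, b), E)`: the function and its weak derivatives of
orders one and two belong to `L^p(a, b)`. -/
def MemW2 (p a b : ℝ) (u : ℝ → E) : Prop :=
  MemLp u (ENNReal.ofReal p) (volume.restrict (Ioo a b)) ∧
    ∃ v w : ℝ → E, IsWeakDeriv a b u v ∧ IsWeakDeriv a b v w ∧
      MemLp v (ENNReal.ofReal p) (volume.restrict (Ioo a b)) ∧
      MemLp w (ENNReal.ofReal p) (volume.restrict (Ioo a b))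

end Sobolev

/-- A curve given by its arc-length parameterization `map` on `[0, length]`. -/
structure Piece (E : Type*) where
  length : ℝ
  map : ℝ → E

namespace Piece

/-- Run through the pieces of a list one after the other; the result is meant on
`[0, totalLength l]`. -/
def concat {E : Type*} [Zero E] : List (Piece E) → ℝ → E
  | [] => fun _ => 0
  | q :: l => fun s => if s ≤ q.length then q.map s else concat l (s - q.length)

def totalLength {E : Type*} (l : List (Piece E)) : ℝ :=
  (l.map Piece.length).sum

variable {E : Type*} [NormedAddCommGroup E] [InnerProductSpace ℝ E]

/-- The segment from `x` to `y`. -/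
def segment (x y : E) : Piece E where
  length := dist x y
  map s := x + (s / dist x y) • (y - x)

/-- The oriented arc rounding off a corner at `x`, with unit incoming direction `e` and unit outgoing
direction `f`, from the point `x - ρ e` to the point `x + ρ f`. If the turning angle `θ` lies in
`(0, π)`, it is the circular arc of opening angle `θ` that has tangent `e` at its initial and `f` at
its final point: its radius is `R = ρ / tan (θ / 2)`, and `ν`, the unit vector orthogonal to `e` in
the plane of `e` and `f`, on the side of `f`, is its initial normal. If `θ = 0`, it is the segment. -/
def arc (x e f : E) (ρ : ℝ) : Piece E :=
  let θ := InnerProductGeometry.angle e f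
  let R := ρ / Real.tan (θ / 2)
  let ν := (Real.sin θ)⁻¹ • (f - Real.cos θ • e)
  if θ = 0 then segment (x - ρ • e) (x + ρ • f)
  else
    { length := R * θ
      map := fun s => (x - ρ • e) + (R * Real.sin (s / R)) • e + (R * (1 - Real.cos (s / R))) • ν }

end Piece

/-- A polygonal with non-degenerate segments inscribed in the curve `c : [0, L] → E`, given by a
partition `0 = t 0 < t 1 < ⋯ < t n = L`; its consecutive vertices are the points `c (t i)`. -/
structure InscribedPolygonal {E : Type*} (c : ℝ → E) (L : ℝ) where
  n : ℕ
  t : Fin (n + 1) → ℝ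
  strictMono : StrictMono t
  t_zero : t 0 = 0
  t_last : t (Fin.last n) = L
  nondegenerate : ∀ i : Fin n, c (t i.castSucc) ≠ c (t i.succ)

namespace InscribedPolygonal

variable {E : Type*} [NormedAddCommGroup E] [InnerProductSpace ℝ E] {c : ℝ → E} {L : ℝ}

/-- The modulus: the largest diameter of the arcs of `c` between consecutive vertices. -/
def modulus (P : InscribedPolygonal c L) : ℝ≥0∞ :=
  ⨆ i : Fin P.n, Metric.ediam (c '' Icc (P.t i.castSucc) (P.t i.succ))

/-- The `i`-th edge, as a vector. -/
def edge (P : InscribedPolygonal c L) (i : Fin P.n) : E :=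
  c (P.t i.succ) - c (P.t i.castSucc)

/-- The edge that follows the `i`-th one in the closed polygonal: after the last edge comes the
first. -/
def next (P : InscribedPolygonal c L) (i : Fin P.n) : Fin P.n :=
  finRotate P.n i

/-- The direction of the `i`-th edge. -/
def dir (P : InscribedPolygonal c L) (i : Fin P.n) : E :=
  ‖P.edge i‖⁻¹ • P.edge i

/-- The vertex at the end of the `i`-th edge. For the last edge of a closed polygonal this is the
base point `c L = c 0`. -/
def vertex (P : InscribedPolygonal c L) (i : Fin P.n) : E :=
  c (P.t i.succ)

/-- The turning angle, in `[0, π]`, at the end of the `i`-th edge. -/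
def turningAngle (P : InscribedPolygonal c L) (i : Fin P.n) : ℝ :=
  InnerProductGeometry.angle (P.edge i) (P.edge (P.next i))

/-- The smaller of the lengths of the two edges that meet at the end of the `i`-th edge. -/
def r (P : InscribedPolygonal c L) (i : Fin P.n) : ℝ :=
  min ‖P.edge i‖ ‖P.edge (P.next i)‖

/-- The arc that replaces the corner at the end of the `i`-th edge; its end points lie on the two
adjacent edges, at distance `r i / 2` from the vertex. -/
def cornerArc (P : InscribedPolygonal c L) (i : Fin P.n) : Piece E :=
  Piece.arc (P.vertex i) (P.dir i) (P.dir (P.next i)) (P.r i / 2)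

/-- The part of the edge `next i` between the arc at its beginning and the arc at its end. -/
def joint (P : InscribedPolygonal c L) (i : Fin P.n) : Piece E :=
  Piece.segment (P.vertex i + (P.r i / 2) • P.dir (P.next i))
    (P.vertex (P.next i) - (P.r (P.next i) / 2) • P.dir (P.next i))

/-- The closed piecewise smooth curve inscribed in the closed polygonal: the corner arcs, the one at
the base point included, each followed by the segment up to the next one. -/
def pieces (P : InscribedPolygonal c L) : List (Piece E) :=
  (List.finRange P.n).flatMap fun i => [P.cornerArc i, P.joint i]

/-- The `p`-rotation (`p > 1`) of a closed polygonal: the integral of the `p`-th power of the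
curvature of the inscribed piecewise smooth curve, which is parameterized by arc length, so that its
curvature is the norm of the second derivative (it exists outside the finite set of junctions);
it is `+∞` if some turning angle equals `π`. -/
def pRotation (P : InscribedPolygonal c L) (p : ℝ) : ℝ≥0∞ :=
  open Classical in
  if ∃ i, P.turningAngle i = Real.pi then ∞
  else ∫⁻ s in Ioo 0 (Piece.totalLength P.pieces), ‖deriv (deriv (Piece.concat P.pieces)) s‖ₑ ^ p

end InscribedPolygonal

/-- The `p`-curvature of the closed curve `c : [0, L] → E`: the infimum of `liminf k_p(P_h)` over all
sequences of inscribed closed polygonals whose moduli tend to `0`. -/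
def pCurvature {E : Type*} [NormedAddCommGroup E] [InnerProductSpace ℝ E]
    (p L : ℝ) (c : ℝ → E) : ℝ≥0∞ :=
  ⨅ (P : ℕ → InscribedPolygonal c L) (_ : Tendsto (fun h => (P h).modulus) atTop (𝓝 0)),
    liminf (fun h => (P h).pRotation p) atTop

end ElasticCurve

end

/-! A corner of angle θ between edges of minimal length r contributes θ (tan(θ/2) / (r/2))^(p-1) to
the p-rotation, and segments contribute nothing (`pRotation_eq`). Everything else estimates these
finite sums.

Lower bound. Since tan x ≥ x, a corner contributes at least θ^p / r^(p-1), and the direction changes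
along the polygonal by at most the sum of the angles passed. Hölder's inequality for sums turns this
into F. Riesz's condition for the directions of the edges, with the p-rotation as bound
(`sum_rpow_div_le`). Small modulus forces small mesh near every parameter, because nontrivial arcs
have positive diameter; hence the directions converge to the derivative of c wherever it exists with
norm one, which is almost everywhere. The limiting condition is used twice: as a Hölder estimate on
a set of full measure, which extends c' to a continuous tangent τ, and then on all of [0, L], where
it makes τ absolutely continuous and, by Fatou, bounds ∫‖τ'‖^p (`exists_isTangent`). The corner at
the base point allows directions to be compared the other way round, which gives τ(0) = τ(L)
(`tangent_closed`).

Upper bound. Given a closed tangent τ with τ' = w in L^p, cut [0, L] into equal intervals of length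
δ. The difference of consecutive edges is the integral of w against a tent of mass δ². Hölder's
inequality, and the fact that the tents add up to δ, give ∑‖v_{k+1} - v_k‖^p ≤ δ^(2p-1) ∫‖w‖^p
(`sum_rpow_norm_edge_sub_le`); the tent across the base point needs τ(0) = τ(L). A corner
contributes at most ‖v_{k+1} - v_k‖^p / δ^(2p-1), up to a factor that tends to 1 (`corner_le`).

The tangents in the two bounds are identified by uniqueness of weak derivatives. `IsTangent` is the
intermediate notion that both finiteness of the p-curvature and the Sobolev condition amount to. -/

namespace ElasticCurve

set_option linter.unusedSectionVars false

/-! ### The p-rotation as a finite sum over the corners. -/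

section PRotation

namespace Piece

variable {E : Type*} [NormedAddCommGroup E] [InnerProductSpace ℝ E]

lemma totalLength_nonneg (l : List (Piece E)) (hl : ∀ q ∈ l, 0 ≤ q.length) :
    0 ≤ totalLength l := by
  refine List.sum_nonneg fun x hx => ?_
  obtain ⟨q, hq, rfl⟩ := List.mem_map.1 hx
  exact hl q hq

lemma lintegral_Ioo_add {a b : ℝ} (ha : 0 ≤ a) (hb : 0 ≤ b) (F : ℝ → ℝ≥0∞) :
    ∫⁻ s in Ioo 0 (a + b), F s = (∫⁻ s in Ioo 0 a, F s) + ∫⁻ s in Ioo a (a + b), F s := by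
  rw [Measure.restrict_congr_set Ioo_ae_eq_Ioc, Measure.restrict_congr_set Ioo_ae_eq_Ioc,
    Measure.restrict_congr_set Ioo_ae_eq_Ioc, ← lintegral_union measurableSet_Ioc,
    Ioc_union_Ioc_eq_Ioc ha (by linarith)]
  rw [Set.disjoint_left]
  intro x hx hx'
  exact absurd hx.2 (not_le.2 hx'.1)

/-- The second derivative is local: inside each open parameter interval the concatenation agrees
near every point with a shifted piece, and the junctions form a null set. -/
lemma lintegral_concat (p : ℝ) (l : List (Piece E)) (hl : ∀ q ∈ l, 0 ≤ q.length) :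
    ∫⁻ s in Ioo 0 (totalLength l), ‖deriv (deriv (concat l)) s‖ₑ ^ p =
      (l.map fun q => ∫⁻ s in Ioo 0 q.length, ‖deriv (deriv q.map) s‖ₑ ^ p).sum := by
  induction l with
  | nil => simp [totalLength]
  | cons q l ih =>
    have hq : 0 ≤ q.length := hl q (by simp)
    have hl' : ∀ q ∈ l, 0 ≤ q.length := fun r hr => hl r (by simp [hr])
    have hT := totalLength_nonneg l hl'
    have htot : totalLength (q :: l) = q.length + totalLength l := by simp [totalLength]
    rw [htot, lintegral_Ioo_add hq hT, List.map_cons, List.sum_cons, ← ih hl']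
    congr 1
    · refine setLIntegral_congr_fun measurableSet_Ioo fun s hs => ?_
      have h : concat (q :: l) =ᶠ[𝓝 s] q.map := by
        filter_upwards [Iio_mem_nhds hs.2] with x hx
        simp [concat, (mem_Iio.1 hx).le]
      simp only [h.deriv.deriv_eq]
    · have h : ∀ s ∈ Ioo q.length (q.length + totalLength l),
          ‖deriv (deriv (concat (q :: l))) s‖ₑ ^ p =
            ‖deriv (deriv (concat l)) (s - q.length)‖ₑ ^ p := by
        intro s hs
        have h : concat (q :: l) =ᶠ[𝓝 s] fun x => concat l (x - q.length) := by
          filter_upwards [Ioi_mem_nhds hs.1] with x hx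
          simp [concat, not_le.2 (mem_Ioi.1 hx)]
        have h2 : deriv (fun x => concat l (x - q.length)) =
            fun x => deriv (concat l) (x - q.length) := by
          ext1 x; rw [deriv_comp_sub_const]
        rw [h.deriv.deriv_eq, h2, deriv_comp_sub_const]
      rw [setLIntegral_congr_fun measurableSet_Ioo h]
      have := (measurePreserving_sub_right volume q.length).setLIntegral_comp_preimage_emb
        (MeasurableEquiv.subRight q.length).measurableEmbedding
        (fun s => ‖deriv (deriv (concat l)) s‖ₑ ^ p) (Ioo 0 (totalLength l))
      rw [← this]
      simp [add_comm]

lemma length_arc_nonneg {x e f : E} {ρ : ℝ} (hρ : 0 ≤ ρ) : 0 ≤ (arc x e f ρ).length := by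
  unfold arc
  have h0 := InnerProductGeometry.angle_nonneg e f
  have h1 := InnerProductGeometry.angle_le_pi e f
  have := Real.tan_nonneg_of_nonneg_of_le_pi_div_two
    (x := InnerProductGeometry.angle e f / 2) (by linarith) (by linarith)
  simp only
  split_ifs
  · exact dist_nonneg
  · simp only
    positivity

lemma energy_segment (x y : E) {p : ℝ} (hp : 0 < p) :
    ∫⁻ s in Ioo 0 (segment x y).length, ‖deriv (deriv (segment x y).map) s‖ₑ ^ p = 0 := by
  have h : deriv (segment x y).map = fun _ => (1 / dist x y) • (y - x) := by
    ext1 s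
    exact ((((hasDerivAt_id s).div_const (dist x y)).smul_const (y - x)).const_add x).deriv
  simp [h, hp]

/-- An arc of radius R has length R θ and constant curvature 1 / R, so its energy is θ R^(1-p) with
R = ρ / tan(θ/2). For θ = 0 both sides vanish. -/
lemma energy_arc (x : E) {e f : E} (he : ‖e‖ = 1) (hf : ‖f‖ = 1) {ρ p : ℝ} (hρ : 0 < ρ)
    (hp : 0 < p) (hπ : InnerProductGeometry.angle e f ≠ Real.pi) :
    ∫⁻ s in Ioo 0 (arc x e f ρ).length, ‖deriv (deriv (arc x e f ρ).map) s‖ₑ ^ p =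
      ENNReal.ofReal (InnerProductGeometry.angle e f *
        (Real.tan (InnerProductGeometry.angle e f / 2) / ρ) ^ (p - 1)) := by
  by_cases h0 : InnerProductGeometry.angle e f = 0
  · simp only [arc, h0, if_true]
    simpa using energy_segment _ _ hp
  have hcos : Real.cos (InnerProductGeometry.angle e f) = inner ℝ e f := by
    rw [InnerProductGeometry.cos_angle, he, hf]; simp
  simp only [arc, h0, if_false]
  have hθ0 : 0 < InnerProductGeometry.angle e f :=
    lt_of_le_of_ne (InnerProductGeometry.angle_nonneg e f) (Ne.symm h0)
  have hθπ : InnerProductGeometry.angle e f < Real.pi :=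
    lt_of_le_of_ne (InnerProductGeometry.angle_le_pi e f) hπ
  generalize InnerProductGeometry.angle e f = θ at *
  have hsin : 0 < Real.sin θ := Real.sin_pos_of_pos_of_lt_pi hθ0 hθπ
  have htan : 0 < Real.tan (θ / 2) :=
    Real.tan_pos_of_pos_of_lt_pi_div_two (by linarith) (by linarith)
  set R := ρ / Real.tan (θ / 2) with hR
  have hRpos : 0 < R := by positivity
  set ν := (Real.sin θ)⁻¹ • (f - Real.cos θ • e) with hν
  -- The vectors `e` and `ν` are orthonormal, so the second derivative has norm 1 / R.
  have hν1 : inner ℝ e ν = 0 := by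
    rw [hν, inner_smul_right, inner_sub_right, inner_smul_right, real_inner_self_eq_norm_sq, he,
      hcos]
    ring
  have hν2 : inner ℝ ν ν = 1 := by
    have : inner ℝ (f - Real.cos θ • e) (f - Real.cos θ • e) = Real.sin θ ^ 2 := by
      rw [inner_sub_left, inner_sub_right, inner_sub_right, inner_smul_left, inner_smul_right,
        inner_smul_left, inner_smul_right, real_inner_self_eq_norm_sq, real_inner_self_eq_norm_sq,
        he, hf, real_inner_comm, ← hcos, Real.sin_sq]
      simp
      ring
    rw [hν, inner_smul_left, inner_smul_right, this]
    simp
    field_simp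
  have hd : ∀ s : ℝ, HasDerivAt (fun s : ℝ => s / R) (1 / R) s := fun s =>
    (hasDerivAt_id s).div_const R
  have h1 : deriv (fun s => (x - ρ • e) + (R * Real.sin (s / R)) • e +
      (R * (1 - Real.cos (s / R))) • ν) =
      fun s => Real.cos (s / R) • e + Real.sin (s / R) • ν := by
    ext1 s
    have := ((((hd s).sin.const_mul R).smul_const e).const_add (x - ρ • e)).add
      ((((hd s).cos.const_sub 1).const_mul R).smul_const ν)
    refine (HasDerivAt.deriv this).trans ?_
    congr 2 <;> field_simp
  have h2 : deriv (fun s => Real.cos (s / R) • e + Real.sin (s / R) • ν) =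
      fun s => (-Real.sin (s / R) * (1 / R)) • e + (Real.cos (s / R) * (1 / R)) • ν := by
    ext1 s
    exact (((hd s).cos.smul_const e).add ((hd s).sin.smul_const ν)).deriv
  have h3 : ∀ s : ℝ, ‖(-Real.sin (s / R) * (1 / R)) • e + (Real.cos (s / R) * (1 / R)) • ν‖ =
      1 / R := by
    intro s
    refine (sq_eq_sq₀ (norm_nonneg _) (by positivity)).1 ?_
    rw [← real_inner_self_eq_norm_sq, inner_add_left, inner_add_right, inner_add_right]
    simp only [inner_smul_left, inner_smul_right, hν1, hν2, real_inner_self_eq_norm_sq, he,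
      real_inner_comm e ν]
    simp
    field_simp
    exact Real.sin_sq_add_cos_sq _
  simp only [h1, h2]
  have h4 : ∀ s : ℝ, ‖(-Real.sin (s / R) * (1 / R)) • e + (Real.cos (s / R) * (1 / R)) • ν‖ₑ ^ p =
      ENNReal.ofReal ((1 / R) ^ p) := fun s => by
    rw [← ofReal_norm, h3, ENNReal.ofReal_rpow_of_pos (by positivity)]
  simp only [h4]
  rw [setLIntegral_const, Real.volume_Ioo, ← ENNReal.ofReal_mul (by positivity)]
  congr 1
  have hk : Real.tan (θ / 2) / ρ = 1 / R := by rw [hR]; field_simp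
  rw [hk, Real.rpow_sub_one (by positivity)]
  field_simp
  ring

end Piece

namespace InscribedPolygonal

variable {E : Type*} [NormedAddCommGroup E] [InnerProductSpace ℝ E] {c : ℝ → E} {L : ℝ}

lemma edge_ne_zero (P : InscribedPolygonal c L) (i : Fin P.n) : P.edge i ≠ 0 :=
  sub_ne_zero.2 (P.nondegenerate i).symm

lemma norm_edge_pos (P : InscribedPolygonal c L) (i : Fin P.n) : 0 < ‖P.edge i‖ :=
  norm_pos_iff.2 (P.edge_ne_zero i)

lemma r_pos (P : InscribedPolygonal c L) (i : Fin P.n) : 0 < P.r i :=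
  lt_min (P.norm_edge_pos _) (P.norm_edge_pos _)

lemma norm_dir (P : InscribedPolygonal c L) (i : Fin P.n) : ‖P.dir i‖ = 1 := by
  rw [dir, norm_smul, norm_inv, norm_norm, inv_mul_cancel₀ (P.norm_edge_pos i).ne']

lemma angle_dir (P : InscribedPolygonal c L) (i j : Fin P.n) :
    InnerProductGeometry.angle (P.dir i) (P.dir j) =
      InnerProductGeometry.angle (P.edge i) (P.edge j) := by
  rw [dir, dir, InnerProductGeometry.angle_smul_left_of_pos _ _ (inv_pos.2 (P.norm_edge_pos i)),
    InnerProductGeometry.angle_smul_right_of_pos _ _ (inv_pos.2 (P.norm_edge_pos j))]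

/-- The contribution of the corner at the end of the `i`-th edge to the `p`-rotation. -/
noncomputable def cornerEnergy (P : InscribedPolygonal c L) (p : ℝ) (i : Fin P.n) : ℝ :=
  P.turningAngle i * (Real.tan (P.turningAngle i / 2) / (P.r i / 2)) ^ (p - 1)

lemma turningAngle_nonneg (P : InscribedPolygonal c L) (i : Fin P.n) : 0 ≤ P.turningAngle i :=
  InnerProductGeometry.angle_nonneg _ _

lemma turningAngle_le_pi (P : InscribedPolygonal c L) (i : Fin P.n) :
    P.turningAngle i ≤ Real.pi :=
  InnerProductGeometry.angle_le_pi _ _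

lemma cornerEnergy_nonneg (P : InscribedPolygonal c L) (p : ℝ) (i : Fin P.n) :
    0 ≤ P.cornerEnergy p i := by
  have h0 := P.turningAngle_nonneg i
  have h1 := P.turningAngle_le_pi i
  have h2 := Real.tan_nonneg_of_nonneg_of_le_pi_div_two
    (x := P.turningAngle i / 2) (by linarith) (by linarith)
  have h3 := P.r_pos i
  unfold cornerEnergy
  positivity

lemma pRotation_eq (P : InscribedPolygonal c L) {p : ℝ} (hp : 0 < p)
    (hπ : ∀ i, P.turningAngle i ≠ Real.pi) :
    P.pRotation p = ENNReal.ofReal (∑ i, P.cornerEnergy p i) := by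
  have hlen : ∀ q ∈ P.pieces, 0 ≤ q.length := by
    intro q hq
    simp only [pieces, List.mem_flatMap, List.mem_finRange, true_and, List.mem_cons,
      List.not_mem_nil, or_false] at hq
    obtain ⟨i, rfl | rfl⟩ := hq
    · exact Piece.length_arc_nonneg (half_pos (P.r_pos i)).le
    · exact dist_nonneg
  rw [pRotation, if_neg (by push Not; exact hπ), Piece.lintegral_concat p _ hlen, pieces,
    List.map_flatMap, ENNReal.ofReal_sum_of_nonneg fun i _ => P.cornerEnergy_nonneg p i,
    Fin.sum_univ_def, List.flatMap_def, List.sum_flatten, List.map_map]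
  congr 1
  refine List.map_congr_left fun i _ => ?_
  have h1 := Piece.energy_arc (P.vertex i) (P.norm_dir i) (P.norm_dir (P.next i))
    (half_pos (P.r_pos i)) hp (by rw [angle_dir]; exact hπ i)
  rw [angle_dir] at h1
  simp only [Function.comp, List.map_cons, List.map_nil, List.sum_cons, List.sum_nil, add_zero,
    cornerArc, joint, Piece.energy_segment _ _ hp, h1]
  rfl

end InscribedPolygonal

end PRotation

/-! ### Riesz's condition for the directions of a polygonal. -/

section Discrete

/-- Hölder's inequality with weights `r` for the quotients `a / r`. -/
lemma rpow_sum_le_sum_div {ι : Type*} (s : Finset ι) (a r : ι → ℝ) {p : ℝ} (hp : 1 < p)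
    (ha : ∀ i ∈ s, 0 ≤ a i) (hr : ∀ i ∈ s, 0 < r i) :
    (∑ i ∈ s, a i) ^ p ≤ (∑ i ∈ s, r i) ^ (p - 1) * ∑ i ∈ s, a i ^ p / r i ^ (p - 1) := by
  classical
  have hS : ∀ f : ι → ℝ, ∑ i ∈ s, f i = ∑ i ∈ s, if i ∈ s then f i else 0 := fun f =>
    Finset.sum_congr rfl fun i hi => by simp [hi]
  -- The weighted inequality asks for nonnegativity at every index, hence the truncation outside
  -- `s`.
  have h := Real.inner_le_weight_mul_Lp_of_nonneg s hp.le (fun i => if i ∈ s then r i else 0)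
    (fun i => if i ∈ s then a i / r i else 0)
    (fun i => by split_ifs with h; exacts [(hr i h).le, le_rfl])
    (fun i => by split_ifs with h; exacts [div_nonneg (ha i h) (hr i h).le, le_rfl])
  have h1 : ∑ i ∈ s, (if i ∈ s then r i else 0) * (if i ∈ s then a i / r i else 0) =
      ∑ i ∈ s, a i := Finset.sum_congr rfl fun i hi => by
    have := hr i hi
    simp only [hi, if_true]; field_simp
  have h2 : ∑ i ∈ s, (if i ∈ s then r i else 0) * (if i ∈ s then a i / r i else 0) ^ p =
      ∑ i ∈ s, a i ^ p / r i ^ (p - 1) := Finset.sum_congr rfl fun i hi => by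
    have := hr i hi
    simp only [hi, if_true]
    rw [Real.div_rpow (ha i hi) this.le, Real.rpow_sub_one this.ne']
    field_simp
  rw [h1, h2, ← hS] at h
  have hr0 : 0 ≤ ∑ i ∈ s, r i := Finset.sum_nonneg fun i hi => (hr i hi).le
  have hq0 : 0 ≤ ∑ i ∈ s, a i ^ p / r i ^ (p - 1) := Finset.sum_nonneg fun i hi => by
    have := hr i hi; have := ha i hi; positivity
  have hp0 : p ≠ 0 := by linarith
  calc (∑ i ∈ s, a i) ^ p ≤ _ := Real.rpow_le_rpow (Finset.sum_nonneg ha) h (by linarith)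
    _ = _ := by
      rw [Real.mul_rpow (by positivity) (by positivity), ← Real.rpow_mul hr0, ← Real.rpow_mul hq0,
        inv_mul_cancel₀ hp0, Real.rpow_one]
      congr 2
      field_simp

variable {E : Type*} [NormedAddCommGroup E] [InnerProductSpace ℝ E]

/-- On the unit sphere the chord is at most the arc: this is 1 - θ²/2 ≤ cos θ. -/
lemma norm_sub_le_angle {x y : E} (hx : ‖x‖ = 1) (hy : ‖y‖ = 1) :
    ‖x - y‖ ≤ InnerProductGeometry.angle x y := by
  refine abs_le_of_sq_le_sq' ?_ (InnerProductGeometry.angle_nonneg x y) |>.2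
  have h := Real.one_sub_sq_div_two_le_cos (x := InnerProductGeometry.angle x y)
  rw [InnerProductGeometry.cos_angle, hx, hy] at h
  rw [@norm_sub_sq_real, hx, hy]
  linarith

lemma finRotate_mk_of_lt {n k : ℕ} (hk : k + 1 < n) :
    finRotate n ⟨k, by omega⟩ = ⟨k + 1, hk⟩ := by
  obtain ⟨m, rfl⟩ : ∃ m, n = m + 1 := ⟨n - 1, by omega⟩
  exact finRotate_of_lt (by omega)

lemma finRotate_mk_of_eq {n k : ℕ} (hk : k + 1 = n) :
    finRotate n ⟨k, by omega⟩ = ⟨0, by omega⟩ := by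
  subst hk
  exact finRotate_last'

namespace InscribedPolygonal

variable {c : ℝ → E} {L : ℝ}

lemma n_pos (P : InscribedPolygonal c L) (hL : 0 < L) : 0 < P.n := by
  rcases Nat.eq_zero_or_pos P.n with h | h
  · exfalso
    have h1 := P.t_zero
    have h2 := P.t_last
    have : (0 : Fin (P.n + 1)) = Fin.last P.n := by ext; simp [h]
    rw [← this, h1] at h2
    exact hL.ne h2
  · exact h

lemma t_mem (P : InscribedPolygonal c L) (i : Fin (P.n + 1)) : P.t i ∈ Icc 0 L := by
  constructor
  · simpa [P.t_zero] using P.strictMono.monotone (Fin.zero_le i)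
  · simpa [P.t_last] using P.strictMono.monotone (Fin.le_last i)

lemma norm_edge_le (P : InscribedPolygonal c L) (hc : LipschitzOnWith 1 c (Icc 0 L))
    (i : Fin P.n) : ‖P.edge i‖ ≤ P.t i.succ - P.t i.castSucc := by
  have h := hc.dist_le_mul _ (P.t_mem i.succ) _ (P.t_mem i.castSucc)
  rw [dist_eq_norm, Real.dist_eq,
    abs_of_pos (sub_pos.2 (P.strictMono i.castSucc_lt_succ))] at h
  simpa [edge] using h

lemma next_of_lt (P : InscribedPolygonal c L) {k : ℕ} (hk : k + 1 < P.n) :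
    P.next ⟨k, by omega⟩ = ⟨k + 1, hk⟩ :=
  finRotate_mk_of_lt hk

lemma next_last (P : InscribedPolygonal c L) {k : ℕ} (hk : k + 1 = P.n) :
    P.next ⟨k, by omega⟩ = ⟨0, by omega⟩ :=
  finRotate_mk_of_eq hk

lemma norm_dir_next_sub (P : InscribedPolygonal c L) (i : Fin P.n) :
    ‖P.dir (P.next i) - P.dir i‖ ≤ P.turningAngle i := by
  rw [norm_sub_rev]
  refine (norm_sub_le_angle (P.norm_dir _) (P.norm_dir _)).trans ?_
  rw [angle_dir]; rfl

/-- The edges from the `i`-th up to, but not including, the `j`-th one. -/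
def block (P : InscribedPolygonal c L) (i j : ℕ) : Finset (Fin P.n) :=
  Finset.univ.filter fun k => i ≤ (k : ℕ) ∧ (k : ℕ) < j

lemma block_succ (P : InscribedPolygonal c L) {i j : ℕ} (hij : i ≤ j) (hj : j < P.n) :
    P.block i (j + 1) = insert ⟨j, hj⟩ (P.block i j) := by
  ext k
  simp only [block, Finset.mem_filter, Finset.mem_univ, true_and, Finset.mem_insert, Fin.ext_iff]
  omega

lemma not_mem_block (P : InscribedPolygonal c L) {i j : ℕ} (hj : j < P.n) :
    (⟨j, hj⟩ : Fin P.n) ∉ P.block i j := by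
  simp [block]

/-- Triangle inequality along the polygonal: corner `k` sits at the end of edge `k`, so `block i j`
also lists the corners passed between edges `i` and `j`. -/
lemma norm_dir_sub_le (P : InscribedPolygonal c L) {i j : ℕ} (hij : i ≤ j) (hj : j < P.n) :
    ‖P.dir ⟨j, hj⟩ - P.dir ⟨i, by omega⟩‖ ≤ ∑ k ∈ P.block i j, P.turningAngle k := by
  induction j, hij using Nat.le_induction with
  | base => simp [Finset.sum_nonneg fun k _ => P.turningAngle_nonneg k]
  | succ j hij ih =>
    rw [P.block_succ hij (by omega), Finset.sum_insert (P.not_mem_block _)]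
    have h1 := ih (by omega)
    have h2 := P.norm_dir_next_sub ⟨j, by omega⟩
    rw [P.next_of_lt hj] at h2
    calc _ = ‖(P.dir ⟨j + 1, hj⟩ - P.dir ⟨j, by omega⟩) +
          (P.dir ⟨j, by omega⟩ - P.dir ⟨i, by omega⟩)‖ := by congr 1; abel
      _ ≤ _ := (norm_add_le _ _).trans (add_le_add h2 h1)

/-- The same comparison along the complementary way, through the base point. It makes the tangent of
the limit close up. -/
lemma norm_dir_sub_le_cyclic (P : InscribedPolygonal c L) {i j : ℕ} (hij : i ≤ j)
    (hj : j < P.n) :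
    ‖P.dir ⟨j, hj⟩ - P.dir ⟨i, by omega⟩‖ ≤
      ∑ k ∈ P.block 0 i ∪ P.block j P.n, P.turningAngle k := by
  obtain ⟨m, hm⟩ : ∃ m, m + 1 = P.n := ⟨P.n - 1, by omega⟩
  have hdis : Disjoint (P.block 0 i) (P.block j P.n) := by
    rw [Finset.disjoint_left]
    intro k
    simp only [block, Finset.mem_filter, Finset.mem_univ, true_and]
    omega
  have hb : P.block j P.n = insert ⟨m, by omega⟩ (P.block j m) := by
    rw [← P.block_succ (by omega), hm]
  rw [Finset.sum_union hdis, hb, Finset.sum_insert (P.not_mem_block _)]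
  have h1 := P.norm_dir_sub_le (i := 0) (j := i) (by omega) (by omega)
  have h2 := P.norm_dir_sub_le (i := j) (j := m) (by omega) (by omega)
  have h3 := P.norm_dir_next_sub ⟨m, by omega⟩
  rw [P.next_last hm] at h3
  rw [norm_sub_rev]
  have : P.dir ⟨i, by omega⟩ - P.dir ⟨j, hj⟩ =
      (P.dir ⟨i, by omega⟩ - P.dir ⟨0, by omega⟩) +
      ((P.dir ⟨0, by omega⟩ - P.dir ⟨m, by omega⟩) + (P.dir ⟨m, by omega⟩ - P.dir ⟨j, hj⟩)) := by
    abel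
  rw [this]
  exact (norm_add_le _ _).trans (add_le_add h1 ((norm_add_le _ _).trans (add_le_add h3 h2)))

/-- Replace tan(θ/2) by the smaller θ/2. -/
lemma rpow_div_le_cornerEnergy (P : InscribedPolygonal c L) {p : ℝ} (hp : 1 < p) {i : Fin P.n}
    (hπ : P.turningAngle i ≠ Real.pi) :
    P.turningAngle i ^ p / P.r i ^ (p - 1) ≤ P.cornerEnergy p i := by
  have h0 := P.turningAngle_nonneg i
  have h1 := lt_of_le_of_ne (P.turningAngle_le_pi i) hπ
  have h2 : P.turningAngle i / 2 ≤ Real.tan (P.turningAngle i / 2) :=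
    Real.le_tan (by linarith) (by linarith)
  have hr := P.r_pos i
  unfold cornerEnergy
  rcases h0.eq_or_lt with h | h
  · rw [← h, Real.zero_rpow (by linarith)]; simp
  have h3 : P.turningAngle i ^ p / P.r i ^ (p - 1) =
      P.turningAngle i * (P.turningAngle i / P.r i) ^ (p - 1) := by
    rw [Real.div_rpow h0 hr.le, Real.rpow_sub_one h.ne']
    field_simp
  rw [h3]
  refine mul_le_mul_of_nonneg_left (Real.rpow_le_rpow (by positivity) ?_ (by linarith)) h0
  rw [div_le_div_iff₀ hr (by positivity)]
  nlinarith

/-- Discrete Hölder with weights `r k`, each of which is at most the length of edge `k`, hence at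
most the length of its parameter interval. -/
lemma rpow_sum_turningAngle_le (P : InscribedPolygonal c L) {p : ℝ} (hp : 1 < p)
    (hc : LipschitzOnWith 1 c (Icc 0 L)) (hπ : ∀ i, P.turningAngle i ≠ Real.pi)
    (S : Finset (Fin P.n)) :
    (∑ k ∈ S, P.turningAngle k) ^ p ≤
      (∑ k ∈ S, (P.t k.succ - P.t k.castSucc)) ^ (p - 1) * ∑ k ∈ S, P.cornerEnergy p k := by
  refine (rpow_sum_le_sum_div S _ P.r hp (fun i _ => P.turningAngle_nonneg i)
    fun i _ => P.r_pos i).trans ?_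
  have hr0 : 0 ≤ ∑ k ∈ S, P.r k := Finset.sum_nonneg fun k _ => (P.r_pos k).le
  have hr1 : ∑ k ∈ S, P.r k ≤ ∑ k ∈ S, (P.t k.succ - P.t k.castSucc) :=
    Finset.sum_le_sum fun k _ => (min_le_left _ _).trans (P.norm_edge_le hc k)
  refine mul_le_mul (Real.rpow_le_rpow hr0 hr1 (by linarith))
    (Finset.sum_le_sum fun k _ => P.rpow_div_le_cornerEnergy hp (hπ k))
    (Finset.sum_nonneg fun i _ => div_nonneg
      (Real.rpow_nonneg (P.turningAngle_nonneg i) _) (Real.rpow_nonneg (P.r_pos i).le _))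
    (Real.rpow_nonneg (hr0.trans hr1) _)

lemma sum_block (P : InscribedPolygonal c L) {i j : ℕ} (hij : i ≤ j) (hj : j ≤ P.n) :
    ∑ k ∈ P.block i j, (P.t k.succ - P.t k.castSucc) =
      P.t ⟨j, by omega⟩ - P.t ⟨i, by omega⟩ := by
  induction j, hij using Nat.le_induction with
  | base =>
    rw [sub_self]
    refine Finset.sum_eq_zero fun k hk => ?_
    simp only [block, Finset.mem_filter, Finset.mem_univ, true_and] at hk
    omega
  | succ j hij ih =>
    rw [P.block_succ hij (by omega), Finset.sum_insert (P.not_mem_block _), ih (by omega)]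
    simp

/-- The number of the edge whose parameter interval contains `x`. -/
noncomputable def index (P : InscribedPolygonal c L) (x : ℝ) : ℕ :=
  -- The bound `P.n - 1` assigns `x = L` to the last edge.
  Nat.findGreatest (fun k => ∃ h : k < P.n + 1, P.t ⟨k, h⟩ ≤ x) (P.n - 1)

lemma index_mono (P : InscribedPolygonal c L) : Monotone P.index := by
  intro x y hxy
  exact Nat.findGreatest_mono (fun k ⟨h, hk⟩ => ⟨h, hk.trans hxy⟩) le_rfl

lemma index_lt (P : InscribedPolygonal c L) (hL : 0 < L) (x : ℝ) : P.index x < P.n := by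
  have := P.n_pos hL
  have h := Nat.findGreatest_le (P := fun k => ∃ h : k < P.n + 1, P.t ⟨k, h⟩ ≤ x) (P.n - 1)
  unfold index
  omega

/-- The edge whose parameter interval contains `x`. -/
noncomputable def edgeAt (P : InscribedPolygonal c L) (hL : 0 < L) (x : ℝ) : Fin P.n :=
  ⟨P.index x, P.index_lt hL x⟩

lemma t_edgeAt_le (P : InscribedPolygonal c L) (hL : 0 < L) {x : ℝ} (hx : x ∈ Icc 0 L) :
    P.t (P.edgeAt hL x).castSucc ≤ x := by
  have h := Nat.findGreatest_spec (P := fun k => ∃ h : k < P.n + 1, P.t ⟨k, h⟩ ≤ x)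
    (m := 0) (n := P.n - 1) (Nat.zero_le _) ⟨by omega, by
      have := P.t_zero
      rw [show (⟨0, by omega⟩ : Fin (P.n + 1)) = 0 from rfl, this]; exact hx.1⟩
  exact h.2

lemma le_t_edgeAt (P : InscribedPolygonal c L) (hL : 0 < L) {x : ℝ} (hx : x ∈ Icc 0 L) :
    x ≤ P.t (P.edgeAt hL x).succ := by
  by_cases h : P.index x + 1 < P.n
  · by_contra hlt
    have := Nat.findGreatest_is_greatest (P := fun k => ∃ h : k < P.n + 1, P.t ⟨k, h⟩ ≤ x)
      (n := P.n - 1) (k := P.index x + 1) (Nat.lt_succ_self _) (by omega)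
    exact this ⟨by omega, (not_le.1 hlt).le⟩
  · have h1 := P.index_lt hL x
    have : (P.edgeAt hL x).succ = Fin.last P.n := by
      ext; simp only [edgeAt, Fin.succ_mk, Fin.val_last]; omega
    rw [this, P.t_last]; exact hx.2

/-- Each summand is bounded by the energy of the corners between the two edges. Since `index` is
monotone, disjoint intervals yield disjoint blocks of corners, so the energies add up to at most the
total. -/
lemma sum_rpow_div_le (P : InscribedPolygonal c L) (hL : 0 < L) {p : ℝ} (hp : 1 < p)
    (hc : LipschitzOnWith 1 c (Icc 0 L)) (hπ : ∀ i, P.turningAngle i ≠ Real.pi)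
    {ι : Type*} (s : Finset ι) (a b : ι → ℝ) (hab : ∀ l ∈ s, a l ≤ b l)
    (hdis : (s : Set ι).PairwiseDisjoint fun l => Ioc (a l) (b l)) :
    ∑ l ∈ s, ‖P.dir (P.edgeAt hL (b l)) - P.dir (P.edgeAt hL (a l))‖ ^ p /
        (P.t (P.edgeAt hL (b l)).castSucc - P.t (P.edgeAt hL (a l)).castSucc) ^ (p - 1) ≤
      ∑ i, P.cornerEnergy p i := by
  classical
  have key : ∀ l ∈ s, ‖P.dir (P.edgeAt hL (b l)) - P.dir (P.edgeAt hL (a l))‖ ^ p /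
        (P.t (P.edgeAt hL (b l)).castSucc - P.t (P.edgeAt hL (a l)).castSucc) ^ (p - 1) ≤
      ∑ i ∈ P.block (P.index (a l)) (P.index (b l)), P.cornerEnergy p i := by
    intro l hl
    have hi := P.index_mono (hab l hl)
    have h1 := P.norm_dir_sub_le hi (P.index_lt hL _)
    have h2 := P.rpow_sum_turningAngle_le hp hc hπ (P.block (P.index (a l)) (P.index (b l)))
    rw [P.sum_block hi (P.index_lt hL _).le] at h2
    have h0 : 0 ≤ P.t (P.edgeAt hL (b l)).castSucc - P.t (P.edgeAt hL (a l)).castSucc :=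
      sub_nonneg.2 (P.strictMono.monotone hi)
    -- This form admits the zero denominator that arises when `a l` and `b l` belong to the same
    -- edge.
    refine div_le_of_le_mul₀ (Real.rpow_nonneg h0 _)
      (Finset.sum_nonneg fun i _ => P.cornerEnergy_nonneg p i) ?_
    rw [mul_comm]
    exact (Real.rpow_le_rpow (norm_nonneg _) h1 (by linarith)).trans h2
  refine (Finset.sum_le_sum key).trans ?_
  rw [← Finset.sum_biUnion]
  · exact Finset.sum_le_univ_sum_of_nonneg fun i => P.cornerEnergy_nonneg p i
  · intro l hl m hm hlm
    have h := hdis hl hm hlm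
    rw [Function.onFun, Set.Ioc_disjoint_Ioc] at h
    rw [Function.onFun, Finset.disjoint_left]
    intro k
    simp only [block, Finset.mem_filter, Finset.mem_univ, true_and]
    intro h1 h2
    rcases le_total (b l) (b m) with hb | hb
    · rw [min_eq_left hb] at h
      rcases le_max_iff.1 h with h | h <;> have := P.index_mono h <;> omega
    · rw [min_eq_right hb] at h
      rcases le_max_iff.1 h with h | h <;> have := P.index_mono h <;> omega

lemma rpow_norm_dir_sub_le_cyclic (P : InscribedPolygonal c L) (hL : 0 < L) {p : ℝ} (hp : 1 < p)
    (hc : LipschitzOnWith 1 c (Icc 0 L)) (hπ : ∀ i, P.turningAngle i ≠ Real.pi)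
    {a b : ℝ} (hab : a ≤ b) :
    ‖P.dir (P.edgeAt hL b) - P.dir (P.edgeAt hL a)‖ ^ p ≤
      (L - P.t (P.edgeAt hL b).castSucc + P.t (P.edgeAt hL a).castSucc) ^ (p - 1) *
        ∑ i, P.cornerEnergy p i := by
  have hi := P.index_mono hab
  have h1 := P.norm_dir_sub_le_cyclic hi (P.index_lt hL _)
  have h2 := P.rpow_sum_turningAngle_le hp hc hπ
    (P.block 0 (P.index a) ∪ P.block (P.index b) P.n)
  have hdis : Disjoint (P.block 0 (P.index a)) (P.block (P.index b) P.n) := by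
    rw [Finset.disjoint_left]
    intro k
    simp only [block, Finset.mem_filter, Finset.mem_univ, true_and]
    omega
  rw [Finset.sum_union hdis (f := fun k : Fin P.n => P.t k.succ - P.t k.castSucc),
    P.sum_block (Nat.zero_le _) (P.index_lt hL _).le,
    P.sum_block (P.index_lt hL _).le le_rfl] at h2
  have h3 : P.t ⟨P.n, by omega⟩ = L := P.t_last
  have h4 : P.t ⟨0, by omega⟩ = 0 := P.t_zero
  rw [h3, h4, sub_zero] at h2
  refine (Real.rpow_le_rpow (norm_nonneg _) h1 (by linarith)).trans (h2.trans ?_)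
  have h5 : P.t ⟨P.index a, (P.index_lt hL a).trans (Nat.lt_succ_self _)⟩ +
      (L - P.t ⟨P.index b, (P.index_lt hL b).trans (Nat.lt_succ_self _)⟩) =
      L - P.t (P.edgeAt hL b).castSucc + P.t (P.edgeAt hL a).castSucc := by
    simp only [edgeAt, Fin.castSucc_mk]; ring
  rw [h5]
  refine mul_le_mul_of_nonneg_left
    (Finset.sum_le_univ_sum_of_nonneg fun i => P.cornerEnergy_nonneg p i) (Real.rpow_nonneg ?_ _)
  have h6 := (P.t_mem (P.edgeAt hL a).castSucc).1
  have h7 := (P.t_mem (P.edgeAt hL b).castSucc).2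
  linarith

end InscribedPolygonal

end Discrete

/-! ### Vector-valued absolutely continuous functions. -/

section AbsolutelyContinuous

lemma _root_.AbsolutelyContinuousOnInterval.of_dist_le {X Y : Type*} [PseudoMetricSpace X]
    [PseudoMetricSpace Y] {f : ℝ → X} {g : ℝ → Y} {a b : ℝ}
    (hg : AbsolutelyContinuousOnInterval g a b)
    (h : ∀ x ∈ uIcc a b, ∀ y ∈ uIcc a b, dist (f x) (f y) ≤ dist (g x) (g y)) :
    AbsolutelyContinuousOnInterval f a b := by
  rw [absolutelyContinuousOnInterval_iff] at *
  intro ε hε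
  obtain ⟨δ, hδ, H⟩ := hg ε hε
  refine ⟨δ, hδ, fun I hI hI' => lt_of_le_of_lt ?_ (H I hI hI')⟩
  exact Finset.sum_le_sum fun i hi => h _ (hI.1 i hi).1 _ (hI.1 i hi).2

variable {E : Type*} [NormedAddCommGroup E] [NormedSpace ℝ E] [CompleteSpace E]

/-- Increments are dominated by those of the real primitive of ‖g‖. -/
lemma absolutelyContinuousOnInterval_integral {g : ℝ → E} {a b c : ℝ}
    (hg : IntervalIntegrable g volume a b) (hc : c ∈ uIcc a b) :
    AbsolutelyContinuousOnInterval (fun x => ∫ v in c..x, g v) a b := by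
  refine (hg.norm.absolutelyContinuousOnInterval_intervalIntegral hc).of_dist_le
    fun x hx y hy => ?_
  have h1 : ∀ z ∈ uIcc a b, IntervalIntegrable g volume c z := fun z hz =>
    hg.mono_set (uIcc_subset_uIcc hc hz)
  rw [dist_eq_norm, intervalIntegral.integral_interval_sub_left (h1 x hx) (h1 y hy),
    Real.dist_eq,
    intervalIntegral.integral_interval_sub_left (h1 x hx).norm (h1 y hy).norm]
  exact intervalIntegral.norm_integral_le_abs_integral_norm

/-- The difference of `f` and a primitive of `f'` is absolutely continuous with derivative zero
almost everywhere, hence constant. -/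
lemma integral_eq_sub_of_absolutelyContinuous {f f' : ℝ → E} {a b : ℝ}
    (hf : AbsolutelyContinuousOnInterval f a b)
    (hd : ∀ᵐ x, x ∈ uIcc a b → HasDerivAt f (f' x) x)
    (hf' : IntervalIntegrable f' volume a b) {x y : ℝ} (hx : x ∈ uIcc a b) (hy : y ∈ uIcc a b) :
    ∫ s in x..y, f' s = f y - f x := by
  have hI : ∀ z ∈ uIcc a b, IntervalIntegrable f' volume a z := fun z hz =>
    hf'.mono_set (uIcc_subset_uIcc left_mem_uIcc hz)
  have hac := hf.sub (absolutelyContinuousOnInterval_integral hf' (c := a) left_mem_uIcc)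
  obtain ⟨C, hC⟩ := hac.const_of_ae_hasDerivAt_zero (by
    filter_upwards [hd, hf'.ae_hasDerivAt_integral] with z h1 h2 hz
    have := (h1 hz).sub (h2 hz a left_mem_uIcc)
    rwa [sub_self] at this)
  have h1 := hC x hx
  have h2 := hC y hy
  simp only [Pi.sub_apply] at h1 h2
  rw [← intervalIntegral.integral_interval_sub_left (hI y hy) (hI x hx)]
  rw [sub_eq_iff_eq_add] at h1 h2
  rw [h1, h2]
  abel

end AbsolutelyContinuous

/-! ### Arc-length parameterization: derivative of norm one and convergence of secant directions. -/

section UnitSpeed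

variable {E : Type*} [NormedAddCommGroup E] [InnerProductSpace ℝ E] {c : ℝ → E} {L : ℝ}

lemma eVariationOn_Icc (hc : HasUnitSpeedOn c (Icc 0 L)) {x y : ℝ} (hx : x ∈ Icc 0 L)
    (hy : y ∈ Icc 0 L) : eVariationOn c (Icc x y) = ENNReal.ofReal (y - x) := by
  have h := hc hx hy
  rwa [inter_eq_self_of_subset_right (Icc_subset_Icc hx.1 hy.2), NNReal.coe_one, one_mul] at h

lemma lipschitzOnWith_of_unitSpeed (hc : HasUnitSpeedOn c (Icc 0 L)) :
    LipschitzOnWith 1 c (Icc 0 L) := by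
  have key : ∀ x ∈ Icc 0 L, ∀ y ∈ Icc 0 L, x ≤ y → edist (c x) (c y) ≤ edist x y := by
    intro x hx y hy hxy
    have h := eVariationOn.edist_le c (left_mem_Icc.2 hxy) (right_mem_Icc.2 hxy)
    rw [eVariationOn_Icc hc hx hy] at h
    rwa [edist_comm x y, edist_dist y x, Real.dist_eq, abs_of_nonneg (sub_nonneg.2 hxy)]
  intro x hx y hy
  rw [ENNReal.coe_one, one_mul]
  rcases le_total x y with h | h
  · exact key x hx y hy h
  · rw [edist_comm (c x), edist_comm x]
    exact key y hy x hx h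

/-- An arc of diameter zero is constant and has no variation. This is what turns small modulus into
small mesh. -/
lemma ediam_pos (hc : HasUnitSpeedOn c (Icc 0 L)) {x y : ℝ} (hx : x ∈ Icc 0 L)
    (hy : y ∈ Icc 0 L) (hxy : x < y) : 0 < Metric.ediam (c '' Icc x y) := by
  by_contra h
  have h0 : Metric.ediam (c '' Icc x y) = 0 := by simpa using h
  have h1 := eVariationOn.constant_on (Metric.ediam_eq_zero_iff.1 h0)
  rw [eVariationOn_Icc hc hx hy, ENNReal.ofReal_eq_zero] at h1
  linarith

/-- The Lipschitz bound gives ‖c'‖ ≤ 1, while the variation L is at most ∫‖c'‖; hence 1 - ‖c'‖ is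
nonnegative with integral zero. -/
lemma ae_norm_deriv_eq_one [FiniteDimensional ℝ E] (hL : 0 < L)
    (hc : HasUnitSpeedOn c (Icc 0 L)) :
    ∀ᵐ x, x ∈ Icc 0 L → DifferentiableAt ℝ c x ∧ ‖deriv c x‖ = 1 := by
  have hu : uIcc 0 L = Icc 0 L := uIcc_of_le hL.le
  have hlip := lipschitzOnWith_of_unitSpeed hc
  have hac : AbsolutelyContinuousOnInterval c 0 L := by
    rw [← hu] at hlip; exact hlip.absolutelyContinuousOnInterval
  have hd := hac.boundedVariationOn.ae_differentiableAt_of_mem_uIcc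
  have h0 : ∀ᵐ x : ℝ, x ≠ 0 := by simp [ae_iff, measure_singleton]
  have h1 : ∀ᵐ x : ℝ, x ≠ L := by simp [ae_iff, measure_singleton]
  rw [hu] at hd
  have hle : ∀ᵐ x, x ∈ Icc 0 L → ‖deriv c x‖ ≤ 1 := by
    filter_upwards [h0, h1] with x hx0 hx1 hx
    exact norm_deriv_le_of_lipschitzOn
      (Icc_mem_nhds (lt_of_le_of_ne hx.1 hx0.symm) (lt_of_le_of_ne hx.2 hx1)) hlip
  have hint : IntervalIntegrable (deriv c) volume 0 L := by
    rw [intervalIntegrable_iff_integrableOn_Ioc_of_le hL.le]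
    refine Measure.integrableOn_of_bounded (M := 1) (by simp)
      (aestronglyMeasurable_deriv c volume) ?_
    rw [ae_restrict_iff' measurableSet_Ioc]
    filter_upwards [hle] with x hx hx' using hx (Ioc_subset_Icc_self hx')
  have hI : ∀ z ∈ Icc 0 L, IntervalIntegrable (deriv c) volume 0 z := fun z hz =>
    hint.mono_set (uIcc_subset_uIcc left_mem_uIcc (hu ▸ hz))
  set F : ℝ → ℝ := fun x => ∫ s in 0..x, ‖deriv c s‖ with hF
  have hFm : ∀ x ∈ Icc 0 L, ∀ y ∈ Icc 0 L, x ≤ y → dist (c x) (c y) ≤ F y - F x := by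
    intro x hx y hy hxy
    rw [dist_comm, dist_eq_norm,
      ← integral_eq_sub_of_absolutelyContinuous hac (by
        rw [hu]; filter_upwards [hd] with z hz hz' using (hz hz').hasDerivAt) hint
        (hu ▸ hx) (hu ▸ hy), hF]
    simp only
    rw [intervalIntegral.integral_interval_sub_left (hI y hy).norm (hI x hx).norm]
    exact intervalIntegral.norm_integral_le_integral_norm hxy
  have hmono : MonotoneOn F (Icc 0 L) := fun x hx y hy hxy =>
    sub_nonneg.1 (dist_nonneg.trans (hFm x hx y hy hxy))
  have hvar : eVariationOn c (Icc 0 L) ≤ eVariationOn F (Icc 0 L) := by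
    refine iSup_le fun q => le_trans (Finset.sum_le_sum fun i _ => ?_)
      (le_iSup (fun q : ℕ × { u : ℕ → ℝ // Monotone u ∧ ∀ i, u i ∈ Icc 0 L } =>
        ∑ i ∈ Finset.range q.1, edist (F (q.2.1 (i + 1))) (F (q.2.1 i))) q)
    rw [edist_dist, edist_dist]
    refine ENNReal.ofReal_le_ofReal ?_
    have h := hFm _ (q.2.2.2 i) _ (q.2.2.2 (i + 1)) (q.2.2.1 (Nat.le_succ i))
    rw [dist_comm, Real.dist_eq]
    exact h.trans (le_abs_self _)
  have h0L : (0 : ℝ) ∈ Icc 0 L := left_mem_Icc.2 hL.le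
  have hLL : L ∈ Icc 0 L := right_mem_Icc.2 hL.le
  have hvF : eVariationOn F (Icc 0 L) ≤ ENNReal.ofReal (F L - F 0) := by
    have := hmono.eVariationOn_eq h0L hLL
    rw [inter_self] at this
    exact this.le
  have hLF : L ≤ F L := by
    have h := hvar.trans hvF
    rw [eVariationOn_Icc hc h0L hLL, ENNReal.ofReal_le_ofReal_iff'] at h
    have hF0 : F 0 = 0 := by simp [hF]
    rcases h with h | h <;> linarith
  have hzero : ∫ s in 0..L, (1 - ‖deriv c s‖) = 0 := by
    have hnn : 0 ≤ ∫ s in 0..L, (1 - ‖deriv c s‖) := by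
      refine intervalIntegral.integral_nonneg_of_ae_restrict hL.le ?_
      rw [EventuallyLE, ae_restrict_iff' measurableSet_Icc]
      filter_upwards [hle] with x hx hx' using sub_nonneg.2 (hx hx')
    refine le_antisymm ?_ hnn
    rw [intervalIntegral.integral_sub (by simp) hint.norm]
    simp only [intervalIntegral.integral_const, sub_zero, smul_eq_mul, mul_one]
    linarith
  rw [intervalIntegral.integral_of_le hL.le, integral_eq_zero_iff_of_nonneg_ae] at hzero
  · rw [EventuallyEq, ae_restrict_iff' measurableSet_Ioc] at hzero
    filter_upwards [hzero, hd, h0] with x h2 h3 h4 hx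
    have := h2 ⟨lt_of_le_of_ne hx.1 h4.symm, hx.2⟩
    simp only [Pi.zero_apply] at this
    exact ⟨h3 hx, by linarith⟩
  · rw [EventuallyLE, ae_restrict_iff' measurableSet_Ioc]
    filter_upwards [hle] with x hx hx' using sub_nonneg.2 (hx (Ioc_subset_Icc_self hx'))
  · have := (intervalIntegrable_const (c := (1 : ℝ))).sub hint.norm
    rwa [intervalIntegrable_iff_integrableOn_Ioc_of_le hL.le] at this

/-- Secants whose end points enclose a point of differentiability converge to the derivative. -/
lemma tendsto_secant {s : Set ℝ} {x : ℝ} {e : E} (hd : HasDerivWithinAt c e s x) {a b : ℕ → ℝ}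
    (has : ∀ h, a h ∈ s) (hbs : ∀ h, b h ∈ s) (hax : ∀ h, a h ≤ x) (hxb : ∀ h, x ≤ b h)
    (hab : ∀ h, a h < b h) (ha : Tendsto a atTop (𝓝 x)) (hb : Tendsto b atTop (𝓝 x)) :
    Tendsto (fun h => (b h - a h)⁻¹ • (c (b h) - c (a h))) atTop (𝓝 e) := by
  rw [Metric.tendsto_atTop']
  intro ε hε
  have h1 := (hasDerivWithinAt_iff_isLittleO.1 hd).bound (half_pos hε)
  have ha' : Tendsto a atTop (𝓝[s] x) := tendsto_nhdsWithin_iff.2 ⟨ha, .of_forall has⟩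
  have hb' : Tendsto b atTop (𝓝[s] x) := tendsto_nhdsWithin_iff.2 ⟨hb, .of_forall hbs⟩
  obtain ⟨n, hn⟩ := eventually_atTop.1 ((ha'.eventually h1).and (hb'.eventually h1))
  refine ⟨n, fun h hh => ?_⟩
  obtain ⟨h2, h3⟩ := hn h hh.le
  have hpos : 0 < b h - a h := sub_pos.2 (hab h)
  -- The error is split into the first-order remainders at `b h` and `a h`. As `x` lies between
  -- them, their bounds add up to ε/2 times `b h - a h`.
  have h4 : (b h - a h)⁻¹ • (c (b h) - c (a h)) - e = (b h - a h)⁻¹ •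
      ((c (b h) - c x - (b h - x) • e) - (c (a h) - c x - (a h - x) • e)) := by
    rw [eq_inv_smul_iff₀ hpos.ne', smul_sub, smul_inv_smul₀ hpos.ne']
    simp only [sub_smul]
    abel
  rw [dist_eq_norm, h4, norm_smul, norm_inv, Real.norm_of_nonneg hpos.le, inv_mul_lt_iff₀ hpos]
  rw [Real.norm_eq_abs, abs_of_nonpos (sub_nonpos.2 (hax h))] at h2
  rw [Real.norm_eq_abs, abs_of_nonneg (sub_nonneg.2 (hxb h))] at h3
  calc _ ≤ _ := norm_sub_le _ _
    _ ≤ ε / 2 * (b h - x) + ε / 2 * -(a h - x) := add_le_add h3 h2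
    _ < _ := by nlinarith

namespace InscribedPolygonal

lemma ediam_le_modulus (P : InscribedPolygonal c L) {x y : ℝ} {i : Fin P.n}
    (hx : P.t i.castSucc ≤ x) (hy : y ≤ P.t i.succ) :
    Metric.ediam (c '' Icc x y) ≤ P.modulus :=
  (Metric.ediam_mono (image_mono (Icc_subset_Icc hx hy))).trans
    (le_iSup (fun i : Fin P.n => Metric.ediam (c '' Icc (P.t i.castSucc) (P.t i.succ))) i)

variable {P : ℕ → InscribedPolygonal c L}

/-- If the next vertex stayed beyond some y > x, the modulus would be at least the positive diameter
of the arc over [x, y]. -/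
lemma tendsto_t_succ_edgeAt (hL : 0 < L) (hc : HasUnitSpeedOn c (Icc 0 L))
    (hP : Tendsto (fun h => (P h).modulus) atTop (𝓝 0)) {x : ℝ} (hx : x ∈ Icc 0 L) :
    Tendsto (fun h => (P h).t ((P h).edgeAt hL x).succ) atTop (𝓝 x) := by
  refine tendsto_order.2 ⟨fun y hy => .of_forall fun h => hy.trans_le ((P h).le_t_edgeAt hL hx),
    fun y hy => ?_⟩
  by_cases hyL : y ≤ L
  · have hy' : y ∈ Icc 0 L := ⟨hx.1.trans hy.le, hyL⟩
    filter_upwards [hP.eventually (gt_mem_nhds (ediam_pos hc hx hy' hy))] with h hh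
    by_contra hle
    exact absurd ((P h).ediam_le_modulus ((P h).t_edgeAt_le hL hx) (not_lt.1 hle)) (not_le.2 hh)
  · exact .of_forall fun h => lt_of_le_of_lt ((P h).t_mem _).2 (not_le.1 hyL)

lemma tendsto_t_castSucc_edgeAt (hL : 0 < L) (hc : HasUnitSpeedOn c (Icc 0 L))
    (hP : Tendsto (fun h => (P h).modulus) atTop (𝓝 0)) {x : ℝ} (hx : x ∈ Icc 0 L) :
    Tendsto (fun h => (P h).t ((P h).edgeAt hL x).castSucc) atTop (𝓝 x) := by
  refine tendsto_order.2 ⟨fun y hy => ?_, fun y hy =>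
    .of_forall fun h => ((P h).t_edgeAt_le hL hx).trans_lt hy⟩
  by_cases hyL : 0 ≤ y
  · have hy' : y ∈ Icc 0 L := ⟨hyL, hy.le.trans hx.2⟩
    filter_upwards [hP.eventually (gt_mem_nhds (ediam_pos hc hy' hx hy))] with h hh
    by_contra hle
    exact absurd ((P h).ediam_le_modulus (not_lt.1 hle) ((P h).le_t_edgeAt hL hx)) (not_le.2 hh)
  · exact .of_forall fun h => lt_of_lt_of_le (not_le.1 hyL) ((P h).t_mem _).1

/-- The edge at `x` is a secant around `x`. Since the limit `e` has norm one, normalizing the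
difference quotient is continuous there. -/
lemma tendsto_dir_edgeAt (hL : 0 < L) (hc : HasUnitSpeedOn c (Icc 0 L))
    (hP : Tendsto (fun h => (P h).modulus) atTop (𝓝 0)) {x : ℝ} (hx : x ∈ Icc 0 L) {e : E}
    (hd : HasDerivWithinAt c e (Icc 0 L) x) (he : ‖e‖ = 1) :
    Tendsto (fun h => (P h).dir ((P h).edgeAt hL x)) atTop (𝓝 e) := by
  have hlt : ∀ h, (P h).t ((P h).edgeAt hL x).castSucc < (P h).t ((P h).edgeAt hL x).succ :=
    fun h => (P h).strictMono Fin.castSucc_lt_succ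
  have h1 := tendsto_secant hd (fun h => (P h).t_mem ((P h).edgeAt hL x).castSucc)
    (fun h => (P h).t_mem ((P h).edgeAt hL x).succ) (fun h => (P h).t_edgeAt_le hL hx)
    (fun h => (P h).le_t_edgeAt hL hx) hlt (tendsto_t_castSucc_edgeAt hL hc hP hx)
    (tendsto_t_succ_edgeAt hL hc hP hx)
  have h2 := (h1.norm.inv₀ (by rw [he]; exact one_ne_zero)).smul h1
  rw [he, inv_one, one_smul] at h2
  refine h2.congr fun h => ?_
  have hpos := sub_pos.2 (hlt h)
  rw [dir, edge, norm_smul, norm_inv, Real.norm_of_nonneg hpos.le, smul_smul]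
  congr 1
  field_simp

end InscribedPolygonal

end UnitSpeed

/-! ### F. Riesz's characterization of primitives of L^p functions. -/

section Riesz

lemma exists_pos_rpow_mul_lt {p : ℝ} (hp : 1 < p) (M : ℝ) {ε : ℝ} (hε : 0 < ε) :
    ∃ δ > 0, ∀ S, 0 ≤ S → S < δ → S ^ (p - 1) * M < ε := by
  have h : Tendsto (fun S : ℝ => S ^ (p - 1) * M) (𝓝 0) (𝓝 0) := by
    have h1 : ContinuousAt (fun S : ℝ => S ^ (p - 1) * M) 0 :=
      (Real.continuousAt_rpow_const _ _ (Or.inr (by linarith))).mul continuousAt_const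
    have h2 := h1.tendsto
    rwa [Real.zero_rpow (by linarith), zero_mul] at h2
  obtain ⟨δ, hδ, H⟩ := Metric.eventually_nhds_iff.1 (h.eventually (gt_mem_nhds hε))
  refine ⟨δ, hδ, fun S h0 h1 => H ?_⟩
  rwa [Real.dist_eq, sub_zero, abs_of_nonneg h0]

lemma lt_of_rpow_lt_rpow {x y p : ℝ} (hp : 0 < p) (hy : 0 ≤ y) (h : x ^ p < y ^ p) :
    x < y := by
  by_contra hle
  exact absurd (Real.rpow_le_rpow hy (not_lt.1 hle) hp.le) (not_le.2 h)

lemma memLp_iff_lintegral {E : Type*} [NormedAddCommGroup E] {p L : ℝ} (hp : 1 < p) {w : ℝ → E} :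
    MemLp w (ENNReal.ofReal p) (volume.restrict (Ioo 0 L)) ↔
      AEStronglyMeasurable w (volume.restrict (Ioo 0 L)) ∧ ∫⁻ s in Ioo 0 L, ‖w s‖ₑ ^ p < ∞ := by
  have hp0 : ENNReal.ofReal p ≠ 0 := by simp; linarith
  rw [MemLp, eLpNorm_lt_top_iff_lintegral_rpow_enorm_lt_top hp0 ENNReal.ofReal_ne_top,
    ENNReal.toReal_ofReal (by linarith)]

lemma intervalIntegrable_of_memLp {E : Type*} [NormedAddCommGroup E] {p L : ℝ} (hp : 1 < p)
    (hL : 0 < L) {w : ℝ → E} (hw : MemLp w (ENNReal.ofReal p) (volume.restrict (Ioo 0 L))) :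
    IntervalIntegrable w volume 0 L := by
  rw [intervalIntegrable_iff_integrableOn_Ioo_of_le hL.le]
  exact hw.integrable (by simpa using hp.le)

lemma lintegral_Ioo_nsmul {h : ℝ} (hh : 0 ≤ h) (n : ℕ) (F : ℝ → ℝ≥0∞) :
    ∫⁻ s in Ioo 0 (n * h), F s =
      ∑ k ∈ Finset.range n, ∫⁻ s in Ioo (k * h) ((k + 1 : ℕ) * h), F s := by
  induction n with
  | zero => simp
  | succ n ih =>
    rw [Finset.sum_range_succ, ← ih]
    have := Piece.lintegral_Ioo_add (a := n * h) (b := h) (by positivity) hh F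
    rwa [show (n : ℝ) * h + h = (n + 1 : ℕ) * h by push_cast; ring] at this

variable {E : Type*} [NormedAddCommGroup E] [InnerProductSpace ℝ E]

/-- F. Riesz's condition: the sums `∑ ‖τ b - τ a‖ ^ p / (b - a) ^ (p - 1)` over finite families of
disjoint intervals are bounded by `M`. -/
def RieszBound (p L M : ℝ) (τ : ℝ → E) : Prop :=
  ∀ (s : Finset ℕ) (a b : ℕ → ℝ), (∀ l ∈ s, a l ∈ Icc 0 L) → (∀ l ∈ s, b l ∈ Icc 0 L) →
    (∀ l ∈ s, a l ≤ b l) → (s : Set ℕ).PairwiseDisjoint (fun l => Ioc (a l) (b l)) →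
    ∑ l ∈ s, ‖τ (b l) - τ (a l)‖ ^ p / (b l - a l) ^ (p - 1) ≤ M

variable {p L M : ℝ} {τ : ℝ → E}

lemma RieszBound.absolutelyContinuous (hp : 1 < p) (hL : 0 < L) (h : RieszBound p L M τ) :
    AbsolutelyContinuousOnInterval τ 0 L := by
  rw [absolutelyContinuousOnInterval_iff]
  intro ε hε
  obtain ⟨δ, hδ, H⟩ := exists_pos_rpow_mul_lt hp M (Real.rpow_pos_of_pos hε p)
  refine ⟨δ, hδ, fun I ⟨hI1, hI2⟩ hI => ?_⟩
  have hu : uIcc 0 L = Icc 0 L := uIcc_of_le hL.le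
  -- Degenerate intervals contribute nothing and are dropped, since Hölder's inequality needs
  -- positive lengths; `a` and `b` order the end points of the others.
  set s := (Finset.range I.1).filter fun i => (I.2 i).1 ≠ (I.2 i).2 with hs
  set a : ℕ → ℝ := fun i => min (I.2 i).1 (I.2 i).2 with ha
  set b : ℕ → ℝ := fun i => max (I.2 i).1 (I.2 i).2 with hb
  have hsub : ∀ i ∈ s, i ∈ Finset.range I.1 := fun i hi => (Finset.mem_filter.1 hi).1
  have hlen : ∀ i, b i - a i = dist (I.2 i).1 (I.2 i).2 := fun i => by
    rw [Real.dist_eq, hb, ha, max_sub_min_eq_abs']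
  have hval : ∀ i, ‖τ (b i) - τ (a i)‖ = dist (τ (I.2 i).1) (τ (I.2 i).2) := fun i => by
    rw [← dist_eq_norm]
    rcases le_total (I.2 i).1 (I.2 i).2 with h | h
    · simp only [hb, ha, max_eq_right h, min_eq_left h]; rw [dist_comm]
    · simp only [hb, ha, max_eq_left h, min_eq_right h]
  have hR := h s a b
    (fun l hl => by
      have := hI1 l (hsub l hl); rw [hu] at this
      exact ⟨le_min this.1.1 this.2.1, (min_le_left _ _).trans this.1.2⟩)
    (fun l hl => by
      have := hI1 l (hsub l hl); rw [hu] at this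
      exact ⟨this.1.1.trans (le_max_left _ _), max_le this.1.2 this.2.2⟩)
    (fun l _ => min_le_max) (fun l hl m hm hlm => hI2 (hsub l hl) (hsub m hm) hlm)
  have h1 := rpow_sum_le_sum_div s (fun i => ‖τ (b i) - τ (a i)‖) (fun i => b i - a i) hp
    (fun _ _ => norm_nonneg _) (fun i hi => by
      rw [hlen]; exact dist_pos.2 (Finset.mem_filter.1 hi).2)
  have hS0 : 0 ≤ ∑ i ∈ s, (b i - a i) := Finset.sum_nonneg fun i _ => sub_nonneg.2 min_le_max
  have hSδ : ∑ i ∈ s, (b i - a i) < δ := by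
    refine lt_of_le_of_lt ?_ hI
    simp only [hlen]
    exact Finset.sum_le_sum_of_subset_of_nonneg (Finset.filter_subset _ _)
      fun _ _ _ => dist_nonneg
  have h2 : ∑ i ∈ Finset.range I.1, dist (τ (I.2 i).1) (τ (I.2 i).2) =
      ∑ i ∈ s, ‖τ (b i) - τ (a i)‖ := by
    simp only [hval]
    rw [hs, Finset.sum_filter]
    refine Finset.sum_congr rfl fun i _ => ?_
    split_ifs with h
    · rfl
    · rw [not_not.1 h, dist_self]
  rw [h2]
  refine lt_of_rpow_lt_rpow (by linarith : (0 : ℝ) < p) hε.le ?_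
  refine lt_of_le_of_lt (h1.trans ?_) (H _ hS0 hSδ)
  exact mul_le_mul_of_nonneg_left hR (Real.rpow_nonneg hS0 _)

/-- The difference quotients over uniform grids converge almost everywhere to the derivative, their
energies are Riesz sums, and Fatou's lemma passes to the limit. -/
lemma RieszBound.lintegral_deriv_le (hp : 1 < p) (hL : 0 < L) (h : RieszBound p L M τ)
    (hd : ∀ᵐ x, x ∈ Icc 0 L → DifferentiableAt ℝ τ x) :
    ∫⁻ s in Ioo 0 L, ‖deriv τ s‖ₑ ^ p ≤ ENNReal.ofReal M := by
  set δ : ℕ → ℝ := fun n => L / (n + 1 : ℕ) with hδ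
  have hδ0 : ∀ n, 0 < δ n := fun n => by positivity
  have hδL : ∀ n, (n + 1 : ℕ) * δ n = L := fun n => by
    simp only [hδ]; field_simp
  have hδlim : Tendsto δ atTop (𝓝 0) :=
    (tendsto_const_div_atTop_nhds_zero_nat L).comp (tendsto_add_atTop_nat 1)
  set G : ℕ → ℕ → ℝ≥0∞ := fun n k =>
    ‖((k + 1 : ℕ) * δ n - k * δ n)⁻¹ • (τ ((k + 1 : ℕ) * δ n) - τ (k * δ n))‖ₑ ^ p with hG
  -- A step function: on each cell of the grid, the p-th power of the norm of the difference
  -- quotient over that cell.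
  set F : ℕ → ℝ → ℝ≥0∞ := fun n x => G n ⌊x / δ n⌋₊ with hF
  have hFm : ∀ n, Measurable (F n) := fun n =>
    (measurable_from_nat (f := G n)).comp (Nat.measurable_floor.comp (measurable_id.div_const _))
  have hlim : ∀ᵐ x, x ∈ Ioo 0 L →
      Tendsto (fun n => F n x) atTop (𝓝 (‖deriv τ x‖ₑ ^ p)) := by
    filter_upwards [hd] with x hx hxL
    have hder := (hx (Ioo_subset_Icc_self hxL)).hasDerivAt.hasDerivWithinAt (s := univ)
    have ha1 : ∀ n, (⌊x / δ n⌋₊ : ℝ) * δ n ≤ x := fun n => by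
      have := Nat.floor_le (div_nonneg hxL.1.le (hδ0 n).le)
      rwa [le_div_iff₀ (hδ0 n)] at this
    have hb1 : ∀ n, x ≤ ((⌊x / δ n⌋₊ + 1 : ℕ) : ℝ) * δ n := fun n => by
      have := (Nat.lt_floor_add_one (x / δ n)).le
      rw [div_le_iff₀ (hδ0 n)] at this
      exact_mod_cast this
    have hab : ∀ n, ((⌊x / δ n⌋₊ + 1 : ℕ) : ℝ) * δ n = (⌊x / δ n⌋₊ : ℝ) * δ n + δ n := fun n => by
      push_cast; ring
    have ha2 : Tendsto (fun n => (⌊x / δ n⌋₊ : ℝ) * δ n) atTop (𝓝 x) := by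
      refine tendsto_of_tendsto_of_tendsto_of_le_of_le (g := fun n => x - δ n)
        (by simpa using tendsto_const_nhds.sub hδlim) tendsto_const_nhds (fun n => ?_) ha1
      have := hb1 n
      rw [hab] at this
      simp only; linarith
    have hb2 : Tendsto (fun n => ((⌊x / δ n⌋₊ + 1 : ℕ) : ℝ) * δ n) atTop (𝓝 x) := by
      simp only [hab]
      simpa using ha2.add hδlim
    have := tendsto_secant hder (fun _ => mem_univ _) (fun _ => mem_univ _) ha1 hb1
      (fun n => by rw [hab]; linarith [hδ0 n]) ha2 hb2
    exact ((ENNReal.continuous_rpow_const (y := p)).tendsto _).comp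
      ((continuous_enorm.tendsto _).comp this)
  have hint : ∀ n, ∫⁻ s in Ioo 0 L, F n s ≤ ENNReal.ofReal M := by
    intro n
    have h1 : ∫⁻ s in Ioo 0 L, F n s = ∑ k ∈ Finset.range (n + 1),
        ENNReal.ofReal (‖τ ((k + 1 : ℕ) * δ n) - τ (k * δ n)‖ ^ p /
          ((k + 1 : ℕ) * δ n - k * δ n) ^ (p - 1)) := by
      rw [← hδL n, lintegral_Ioo_nsmul (hδ0 n).le]
      refine Finset.sum_congr rfl fun k _ => ?_
      have h2 : ∀ s ∈ Ioo (k * δ n) ((k + 1 : ℕ) * δ n), F n s = G n k := by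
        intro s hs
        have : ⌊s / δ n⌋₊ = k := by
          rw [Nat.floor_eq_iff (div_nonneg (le_trans (by have := hδ0 n; positivity) hs.1.le)
            (hδ0 n).le), le_div_iff₀ (hδ0 n), div_lt_iff₀ (hδ0 n)]
          exact ⟨hs.1.le, by exact_mod_cast hs.2⟩
        simp only [hF, this]
      have hd : ((k + 1 : ℕ) : ℝ) * δ n - k * δ n = δ n := by push_cast; ring
      rw [setLIntegral_congr_fun measurableSet_Ioo h2, setLIntegral_const, Real.volume_Ioo]
      simp only [hG, hd]
      rw [← ofReal_norm, norm_smul, norm_inv, Real.norm_of_nonneg (hδ0 n).le,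
        ENNReal.ofReal_rpow_of_nonneg (by have := hδ0 n; positivity) (by linarith),
        ← ENNReal.ofReal_mul (by have := hδ0 n; positivity)]
      congr 1
      rw [Real.mul_rpow (by have := hδ0 n; positivity) (norm_nonneg _),
        Real.inv_rpow (hδ0 n).le, Real.rpow_sub_one (hδ0 n).ne']
      have := Real.rpow_pos_of_pos (hδ0 n) p
      have := hδ0 n
      field_simp
    have hmono : Monotone fun k : ℕ => (k : ℝ) * δ n := fun i j hij =>
      mul_le_mul_of_nonneg_right (by exact_mod_cast hij) (hδ0 n).le
    have hmem : ∀ k ≤ n + 1, (k : ℝ) * δ n ∈ Icc 0 L := fun k hk =>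
      ⟨by have := hδ0 n; positivity, by rw [← hδL n]; exact hmono hk⟩
    rw [h1, ← ENNReal.ofReal_sum_of_nonneg]
    · refine ENNReal.ofReal_le_ofReal (h (Finset.range (n + 1)) (fun k => k * δ n)
        (fun k => (k + 1 : ℕ) * δ n) (fun k hk => hmem k (Finset.mem_range.1 hk).le)
        (fun k hk => hmem (k + 1) (Finset.mem_range.1 hk)) (fun k _ => hmono (Nat.le_succ k)) ?_)
      exact fun k _ l _ hkl => hmono.pairwise_disjoint_on_Ioc_succ hkl
    · intro k _
      exact div_nonneg (Real.rpow_nonneg (norm_nonneg _) _)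
        (Real.rpow_nonneg (sub_nonneg.2 (hmono (Nat.le_succ k))) _)
  calc ∫⁻ s in Ioo 0 L, ‖deriv τ s‖ₑ ^ p = ∫⁻ s in Ioo 0 L, liminf (fun n => F n s) atTop := by
        refine lintegral_congr_ae ?_
        rw [EventuallyEq, ae_restrict_iff' measurableSet_Ioo]
        filter_upwards [hlim] with x hx hx' using (hx hx').liminf_eq.symm
    _ ≤ liminf (fun n => ∫⁻ s in Ioo 0 L, F n s) atTop := lintegral_liminf_le hFm
    _ ≤ liminf (fun _ : ℕ => ENNReal.ofReal M) atTop := liminf_le_liminf (.of_forall hint)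
    _ = _ := by simp

end Riesz

/-! ### Lower bound: bounded p-rotation yields a closed tangent with derivative in L^p. -/

section LowerBound

variable {E : Type*} [NormedAddCommGroup E] [InnerProductSpace ℝ E]

/-- `τ` is the tangent of the curve `c`, it closes up, and it is the primitive of the `L^p`
function `w`. -/
structure IsTangent (p L : ℝ) (c τ w : ℝ → E) : Prop where
  hasDeriv : ∀ x ∈ Icc 0 L, HasDerivWithinAt c (τ x) (Icc 0 L) x
  eq_integral : ∀ x ∈ Icc 0 L, τ x = τ 0 + ∫ s in 0..x, w s
  closed : τ 0 = τ L
  memLp : MemLp w (ENNReal.ofReal p) (volume.restrict (Ioo 0 L))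

variable {c : ℝ → E} {p L M : ℝ}

/-- The norm of the tangent is continuous and equals one almost everywhere. -/
lemma norm_tangent_eq_one [FiniteDimensional ℝ E] (hL : 0 < L) (hc : HasUnitSpeedOn c (Icc 0 L))
    {τ : ℝ → E} (hτ : ContinuousOn τ (Icc 0 L))
    (hd : ∀ x ∈ Icc 0 L, HasDerivWithinAt c (τ x) (Icc 0 L) x) {x : ℝ} (hx : x ∈ Icc 0 L) :
    ‖τ x‖ = 1 := by
  have h1 : ∀ᵐ y ∂volume.restrict (Icc 0 L), ‖τ y‖ = 1 := by
    rw [ae_restrict_iff' measurableSet_Icc]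
    filter_upwards [ae_norm_deriv_eq_one hL hc] with y hy hyL
    obtain ⟨hy1, hy2⟩ := hy hyL
    rw [← hy2, ← (hd y hyL).derivWithin (uniqueDiffOn_Icc hL y hyL),
      hy1.derivWithin (uniqueDiffOn_Icc hL y hyL)]
  have h2 := Measure.eqOn_Icc_of_ae_eq volume hL.ne (f := fun y => ‖τ y‖) (g := fun _ => (1 : ℝ))
    h1 hτ.norm continuousOn_const
  exact h2 hx

namespace InscribedPolygonal

lemma turningAngle_ne_pi {P : InscribedPolygonal c L} (h : P.pRotation p ≠ ∞) (i : Fin P.n) :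
    P.turningAngle i ≠ Real.pi := fun hi => h (by rw [pRotation, if_pos ⟨i, hi⟩])

lemma sum_cornerEnergy_le {P : InscribedPolygonal c L} (hp : 1 < p) (hM : 0 ≤ M)
    (h : P.pRotation p ≤ ENNReal.ofReal M) :
    (∀ i, P.turningAngle i ≠ Real.pi) ∧ ∑ i, P.cornerEnergy p i ≤ M := by
  have hπ : ∀ i, P.turningAngle i ≠ Real.pi :=
    turningAngle_ne_pi (h.trans_lt ENNReal.ofReal_lt_top).ne
  rw [P.pRotation_eq (by linarith) hπ, ENNReal.ofReal_le_ofReal_iff hM] at h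
  exact ⟨hπ, h⟩

variable {P : ℕ → InscribedPolygonal c L}

/-- Limit of the Riesz bound for the polygonals. The set `S` is left free because the bound serves
first at the differentiability points and then on the whole interval. -/
lemma sum_tangent_le (hL : 0 < L) (hp : 1 < p) (hM : 0 ≤ M) (hc : HasUnitSpeedOn c (Icc 0 L))
    (hP : Tendsto (fun h => (P h).modulus) atTop (𝓝 0))
    (hPM : ∀ h, (P h).pRotation p ≤ ENNReal.ofReal M) {T : ℝ → E} {S : Set ℝ}
    (hS : S ⊆ Icc 0 L) (hT : ∀ x ∈ S, HasDerivWithinAt c (T x) (Icc 0 L) x)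
    (hT1 : ∀ x ∈ S, ‖T x‖ = 1) {ι : Type*} (s : Finset ι) (a b : ι → ℝ)
    (ha : ∀ l ∈ s, a l ∈ S) (hb : ∀ l ∈ s, b l ∈ S) (hab : ∀ l ∈ s, a l ≤ b l)
    (hdis : (s : Set ι).PairwiseDisjoint fun l => Ioc (a l) (b l)) :
    ∑ l ∈ s, ‖T (b l) - T (a l)‖ ^ p / (b l - a l) ^ (p - 1) ≤ M := by
  have h1 : ∀ h, ∑ l ∈ s, ‖(P h).dir ((P h).edgeAt hL (b l)) -
      (P h).dir ((P h).edgeAt hL (a l))‖ ^ p /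
        ((P h).t ((P h).edgeAt hL (b l)).castSucc -
          (P h).t ((P h).edgeAt hL (a l)).castSucc) ^ (p - 1) ≤ M := fun h =>
    ((P h).sum_rpow_div_le hL hp (lipschitzOnWith_of_unitSpeed hc)
      (sum_cornerEnergy_le hp hM (hPM h)).1 s a b hab hdis).trans
      (sum_cornerEnergy_le hp hM (hPM h)).2
  refine le_of_tendsto' (x := (atTop : Filter ℕ)) (tendsto_finsetSum s fun l hl => ?_) h1
  -- For `a l = b l` the summand is zero for every polygonal; otherwise the limit of the
  -- denominators is positive.
  rcases (hab l hl).eq_or_lt with h | h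
  · simp [h, Real.zero_rpow (by linarith : p ≠ 0)]
  · have hdir : ∀ x ∈ S, Tendsto (fun h => (P h).dir ((P h).edgeAt hL x)) atTop (𝓝 (T x)) :=
      fun x hx => tendsto_dir_edgeAt hL hc hP (hS hx) (hT x hx) (hT1 x hx)
    refine Tendsto.div (((hdir _ (hb l hl)).sub (hdir _ (ha l hl))).norm.rpow_const
      (Or.inr (by linarith))) (((tendsto_t_castSucc_edgeAt hL hc hP (hS (hb l hl))).sub
      (tendsto_t_castSucc_edgeAt hL hc hP (hS (ha l hl)))).rpow_const (Or.inr (by linarith)))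
      (Real.rpow_pos_of_pos (sub_pos.2 h) _).ne'

/-- Compare the last and the first edge through the base point: the parameter length of the corners
involved tends to zero while their energy stays below `M`. -/
lemma tangent_closed (hL : 0 < L) (hp : 1 < p) (hM : 0 ≤ M) (hc : HasUnitSpeedOn c (Icc 0 L))
    (hP : Tendsto (fun h => (P h).modulus) atTop (𝓝 0))
    (hPM : ∀ h, (P h).pRotation p ≤ ENNReal.ofReal M) {e f : E}
    (he : HasDerivWithinAt c e (Icc 0 L) 0) (hf : HasDerivWithinAt c f (Icc 0 L) L)
    (he1 : ‖e‖ = 1) (hf1 : ‖f‖ = 1) : e = f := by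
  have h0 : (0 : ℝ) ∈ Icc 0 L := left_mem_Icc.2 hL.le
  have h1 : L ∈ Icc 0 L := right_mem_Icc.2 hL.le
  have h2 : ∀ h, ‖(P h).dir ((P h).edgeAt hL L) - (P h).dir ((P h).edgeAt hL 0)‖ ^ p ≤
      (L - (P h).t ((P h).edgeAt hL L).castSucc +
        (P h).t ((P h).edgeAt hL 0).castSucc) ^ (p - 1) * M := by
    intro h
    refine ((P h).rpow_norm_dir_sub_le_cyclic hL hp (lipschitzOnWith_of_unitSpeed hc)
      (sum_cornerEnergy_le hp hM (hPM h)).1 hL.le).trans ?_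
    refine mul_le_mul_of_nonneg_left (sum_cornerEnergy_le hp hM (hPM h)).2 (Real.rpow_nonneg ?_ _)
    have h6 := ((P h).t_mem ((P h).edgeAt hL 0).castSucc).1
    have h7 := ((P h).t_mem ((P h).edgeAt hL L).castSucc).2
    linarith
  have h3 := ((tendsto_dir_edgeAt hL hc hP h1 hf hf1).sub
    (tendsto_dir_edgeAt hL hc hP h0 he he1)).norm.rpow_const (p := p) (Or.inr (by linarith))
  have h4 := ((((tendsto_t_castSucc_edgeAt hL hc hP h1).const_sub L).add
    (tendsto_t_castSucc_edgeAt hL hc hP h0)).rpow_const (p := p - 1)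
    (Or.inr (by linarith))).mul_const M
  have h5 := le_of_tendsto_of_tendsto' h3 h4 h2
  rw [sub_self, add_zero, Real.zero_rpow (by linarith), zero_mul] at h5
  have h6 : ‖f - e‖ = 0 := by
    by_contra hne
    have := Real.rpow_pos_of_pos (lt_of_le_of_ne (norm_nonneg _) (Ne.symm hne)) p
    linarith
  exact (sub_eq_zero.1 (norm_eq_zero.1 h6)).symm

end InscribedPolygonal

/-- A function that is Hölder continuous on a dense subset of an interval has limits. -/
lemma exists_tendsto_of_rpow_le [CompleteSpace E] (hp : 1 < p) {D : Set ℝ} {f : ℝ → E}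
    (hf : ∀ x ∈ D, ∀ y ∈ D, x ≤ y → ‖f y - f x‖ ^ p ≤ (y - x) ^ (p - 1) * M) {x : ℝ}
    (hx : x ∈ closure D) : ∃ y, Tendsto f (𝓝[D] x) (𝓝 y) := by
  have : NeBot (𝓝[D] x) := mem_closure_iff_nhdsWithin_neBot.1 hx
  refine cauchy_map_iff_exists_tendsto.1 (Metric.cauchy_iff.2 ⟨inferInstance, fun ε hε => ?_⟩)
  obtain ⟨δ, hδ, H⟩ := exists_pos_rpow_mul_lt hp M (Real.rpow_pos_of_pos hε p)
  refine ⟨f '' (Metric.ball x (δ / 2) ∩ D), image_mem_map (inter_mem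
    (mem_nhdsWithin_of_mem_nhds (Metric.ball_mem_nhds x (half_pos hδ))) self_mem_nhdsWithin), ?_⟩
  have key : ∀ y ∈ Metric.ball x (δ / 2) ∩ D, ∀ z ∈ Metric.ball x (δ / 2) ∩ D, y ≤ z →
      dist (f z) (f y) < ε := by
    intro y hy z hz hyz
    rw [dist_eq_norm]
    refine lt_of_rpow_lt_rpow (by linarith : (0 : ℝ) < p) hε.le ?_
    refine (hf y hy.2 z hz.2 hyz).trans_lt (H _ (sub_nonneg.2 hyz) ?_)
    have h1 := Metric.mem_ball.1 hy.1
    have h2 := Metric.mem_ball.1 hz.1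
    rw [Real.dist_eq, abs_lt] at h1 h2
    linarith
  rintro _ ⟨y, hy, rfl⟩ _ ⟨z, hz, rfl⟩
  rcases le_total y z with h | h
  · rw [dist_comm]; exact key y hy z hz h
  · exact key z hz y hy h

lemma hasDerivWithinAt_of_eq_integral [CompleteSpace E] {τ : ℝ → E} (hL : 0 < L)
    (hτ : ContinuousOn τ (Icc 0 L)) (hc : ∀ x ∈ Icc 0 L, c x = c 0 + ∫ s in 0..x, τ s) {x : ℝ}
    (hx : x ∈ Icc 0 L) : HasDerivWithinAt c (τ x) (Icc 0 L) x := by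
  set T : ℝ → E := IccExtend hL.le ((Icc 0 L).domRestrict τ) with hT
  have hTc : Continuous T := (continuousOn_iff_continuous_domRestrict.1 hτ).Icc_extend'
  have hTe : ∀ y ∈ Icc 0 L, T y = τ y := fun y hy => IccExtend_of_mem hL.le _ hy
  have h1 := ((hTc.integral_hasStrictDerivAt 0 x).hasDerivAt.const_add (c 0)).hasDerivWithinAt
    (s := Icc 0 L)
  rw [hTe x hx] at h1
  have h2 : ∀ y ∈ Icc 0 L, c y = c 0 + ∫ s in 0..y, T s := by
    intro y hy
    rw [hc y hy]
    congr 1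
    refine intervalIntegral.integral_congr fun z hz => ?_
    rw [uIcc_of_le hy.1] at hz
    exact (hTe z ⟨hz.1, hz.2.trans hy.2⟩).symm
  exact h1.congr h2 (h2 x hx)

/-- A bootstrap: the Hölder bound on the full-measure set `D` extends c' continuously, so c is
differentiable on all of [0, L], and then the Riesz bound holds there without exceptional points. -/
theorem exists_isTangent [FiniteDimensional ℝ E] (hL : 0 < L) (hp : 1 < p) (hM : 0 ≤ M)
    (hc : HasUnitSpeedOn c (Icc 0 L)) {P : ℕ → InscribedPolygonal c L}
    (hP : Tendsto (fun h => (P h).modulus) atTop (𝓝 0))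
    (hPM : ∀ h, (P h).pRotation p ≤ ENNReal.ofReal M) :
    ∃ τ w : ℝ → E, IsTangent p L c τ w ∧ ∫⁻ s in Ioo 0 L, ‖w s‖ₑ ^ p ≤ ENNReal.ofReal M := by
  have := FiniteDimensional.complete ℝ E
  have hu : uIcc 0 L = Icc 0 L := uIcc_of_le hL.le
  have hae := ae_norm_deriv_eq_one hL hc
  set D : Set ℝ := {x | x ∈ Icc 0 L ∧ DifferentiableAt ℝ c x ∧ ‖deriv c x‖ = 1} with hD
  have hDsub : D ⊆ Icc 0 L := fun x hx => hx.1
  have hDae : ∀ᵐ x, x ∈ Icc 0 L → x ∈ D := by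
    filter_upwards [hae] with x hx hx' using ⟨hx', hx hx'⟩
  have hcl : Icc 0 L ⊆ closure D := by
    -- A nonempty open subset of (0, L) has positive measure, so it cannot miss `D`.
    rw [← closure_Ioo hL.ne]
    refine closure_minimal (fun x hx => ?_) isClosed_closure
    rw [mem_closure_iff]
    intro o ho hxo
    have hpos : volume (o ∩ Ioo 0 L) ≠ 0 :=
      ((ho.inter isOpen_Ioo).measure_pos volume ⟨x, hxo, hx⟩).ne'
    by_contra hem
    refine hpos (measure_mono_null (fun y hy => ?_) hDae)
    intro hy'
    exact hem ⟨y, hy.1, hy' (Ioo_subset_Icc_self hy.2)⟩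
  -- The Riesz bound for a single interval.
  have hHolder : ∀ x ∈ D, ∀ y ∈ D, x ≤ y →
      ‖deriv c y - deriv c x‖ ^ p ≤ (y - x) ^ (p - 1) * M := by
    intro x hx y hy hxy
    rcases hxy.eq_or_lt with rfl | hlt
    · simp [Real.zero_rpow (by linarith : p ≠ 0), Real.zero_rpow (by linarith : p - 1 ≠ 0)]
    have h := InscribedPolygonal.sum_tangent_le hL hp hM hc hP hPM hDsub (T := deriv c)
      (fun z hz => hz.2.1.hasDerivAt.hasDerivWithinAt) (fun z hz => hz.2.2)
      ({()} : Finset Unit) (fun _ => x) (fun _ => y) (by simp [hx]) (by simp [hy]) (by simp [hxy])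
      (by simp)
    rw [Finset.sum_singleton, div_le_iff₀ (Real.rpow_pos_of_pos (sub_pos.2 hlt) _)] at h
    rwa [mul_comm]
  have hlim : ∀ x ∈ Icc 0 L, ∃ y, Tendsto (deriv c) (𝓝[D] x) (𝓝 y) := fun x hx =>
    exists_tendsto_of_rpow_le hp hHolder (hcl hx)
  set τ₀ := extendFrom D (deriv c) with hτ₀
  have hτ₀c : ContinuousOn τ₀ (Icc 0 L) := continuousOn_extendFrom hcl hlim
  -- For `x ∈ D` the filter `𝓝[D] x` contains the point itself, so the limit can only be the value.
  have hτ₀D : ∀ x ∈ D, τ₀ x = deriv c x := by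
    intro x hx
    obtain ⟨y, hy⟩ := hlim x hx.1
    have : y = deriv c x :=
      (tendsto_nhds_unique (tendsto_pure_nhds (deriv c) x)
        (hy.mono_left (pure_le_nhdsWithin hx))).symm
    exact (extendFrom_eq (subset_closure hx) hy).trans this
  have hac : AbsolutelyContinuousOnInterval c 0 L := by
    have := lipschitzOnWith_of_unitSpeed hc
    rw [← hu] at this; exact this.absolutelyContinuousOnInterval
  have hcI : ∀ x ∈ Icc 0 L, c x = c 0 + ∫ s in 0..x, τ₀ s := by
    intro x hx
    rw [integral_eq_sub_of_absolutelyContinuous hac (f' := τ₀) (by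
      rw [hu]
      filter_upwards [hDae] with z hz hz'
      rw [hτ₀D z (hz hz')]
      exact (hz hz').2.1.hasDerivAt) (hu ▸ hτ₀c).intervalIntegrable
      (hu ▸ left_mem_Icc.2 hL.le) (hu ▸ hx)]
    abel
  have hder : ∀ x ∈ Icc 0 L, HasDerivWithinAt c (τ₀ x) (Icc 0 L) x := fun x hx =>
    hasDerivWithinAt_of_eq_integral hL hτ₀c hcI hx
  have hnorm : ∀ x ∈ Icc 0 L, ‖τ₀ x‖ = 1 := fun x hx => norm_tangent_eq_one hL hc hτ₀c hder hx
  have hR : RieszBound p L M τ₀ := fun s a b ha hb hab hdis =>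
    InscribedPolygonal.sum_tangent_le hL hp hM hc hP hPM Subset.rfl hder hnorm s a b ha hb hab hdis
  have hτac := hR.absolutelyContinuous hp hL
  have hτd := hτac.boundedVariationOn.ae_differentiableAt_of_mem_uIcc
  rw [hu] at hτd
  have hwM := hR.lintegral_deriv_le hp hL hτd
  have hmem : MemLp (deriv τ₀) (ENNReal.ofReal p) (volume.restrict (Ioo 0 L)) :=
    (memLp_iff_lintegral hp).2 ⟨aestronglyMeasurable_deriv _ _,
      hwM.trans_lt ENNReal.ofReal_lt_top⟩
  refine ⟨τ₀, deriv τ₀, ⟨hder, fun x hx => ?_, ?_, hmem⟩, hwM⟩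
  · rw [integral_eq_sub_of_absolutelyContinuous hτac (by
      rw [hu]; filter_upwards [hτd] with z hz hz' using (hz hz').hasDerivAt)
      (intervalIntegrable_of_memLp hp hL hmem) (hu ▸ left_mem_Icc.2 hL.le) (hu ▸ hx)]
    abel
  · have h0 : (0 : ℝ) ∈ Icc 0 L := left_mem_Icc.2 hL.le
    have h1 : L ∈ Icc 0 L := right_mem_Icc.2 hL.le
    exact InscribedPolygonal.tangent_closed hL hp hM hc hP hPM (hder 0 h0) (hder L h1)
      (hnorm 0 h0) (hnorm L h1)

end LowerBound

/-! ### Weak derivatives: uniqueness, primitives, the lemma of du Bois-Reymond. -/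

section WeakDerivative

variable {E : Type*} [NormedAddCommGroup E] [NormedSpace ℝ E]

lemma integrable_smul_of_tsupport_subset {a b : ℝ} {φ : ℝ → ℝ} {g : ℝ → E} (hφ : Continuous φ)
    (hφc : HasCompactSupport φ) (hφs : tsupport φ ⊆ Ioo a b)
    (hg : LocallyIntegrableOn g (Ioo a b) volume) : Integrable (fun s => φ s • g s) volume := by
  have h1 : IntegrableOn g (tsupport φ) volume := hg.integrableOn_compact_subset hφs hφc
  have h2 : IntegrableOn (fun s => φ s • g s) (tsupport φ) volume :=
    h1.continuousOn_smul hφ.continuousOn hφc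
  refine (integrableOn_iff_integrable_of_support_subset fun x hx => ?_).1 h2
  refine subset_tsupport φ fun h => hx ?_
  simp [h]

lemma setIntegral_smul_of_tsupport_subset {a b : ℝ} {φ : ℝ → ℝ} {g : ℝ → E}
    (hφs : tsupport φ ⊆ Ioo a b) : ∫ s in Ioo a b, φ s • g s = ∫ s, φ s • g s :=
  setIntegral_eq_integral_of_forall_compl_eq_zero fun x hx => by
    rw [image_eq_zero_of_notMem_tsupport fun h => hx (hφs h), zero_smul]

lemma ae_eq_of_forall_integral_smul_eq [CompleteSpace E] {a b : ℝ} {f g : ℝ → E}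
    (hf : LocallyIntegrableOn f (Ioo a b) volume) (hg : LocallyIntegrableOn g (Ioo a b) volume)
    (h : ∀ φ : ℝ → ℝ, ContDiff ℝ ((⊤ : ℕ∞) : WithTop ℕ∞) φ → HasCompactSupport φ →
      tsupport φ ⊆ Ioo a b → ∫ s in Ioo a b, φ s • f s = ∫ s in Ioo a b, φ s • g s) :
    f =ᵐ[volume.restrict (Ioo a b)] g := by
  rw [EventuallyEq, ae_restrict_iff' measurableSet_Ioo]
  have := isOpen_Ioo.ae_eq_zero_of_integral_contDiff_smul_eq_zero (hf.sub hg)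
    fun φ h1 h2 h3 => by
      simp only [Pi.sub_apply, smul_sub]
      rw [integral_sub (integrable_smul_of_tsupport_subset h1.continuous h2 h3 hf)
        (integrable_smul_of_tsupport_subset h1.continuous h2 h3 hg),
        ← setIntegral_smul_of_tsupport_subset h3, ← setIntegral_smul_of_tsupport_subset h3,
        h φ h1 h2 h3, sub_self]
  filter_upwards [this] with x hx hx' using sub_eq_zero.1 (hx hx')

lemma IsWeakDeriv.ae_eq [CompleteSpace E] {a b : ℝ} {u u' g g' : ℝ → E}
    (h : IsWeakDeriv a b u g) (h' : IsWeakDeriv a b u' g')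
    (hu : u =ᵐ[volume.restrict (Ioo a b)] u') : g =ᵐ[volume.restrict (Ioo a b)] g' := by
  refine ae_eq_of_forall_integral_smul_eq h.2.1 h'.2.1 fun φ h1 h2 h3 => ?_
  rw [← neg_inj, ← h.2.2 φ h1 h2 h3, ← h'.2.2 φ h1 h2 h3]
  refine integral_congr_ae ?_
  filter_upwards [hu] with x hx
  rw [hx]

/-- The product of a test function with a primitive is absolutely continuous and vanishes at both
ends, so the integral of its derivative is zero. -/
lemma isWeakDeriv_of_eq_integral [CompleteSpace E] {L : ℝ} (hL : 0 < L) {u g : ℝ → E} {C : E}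
    (hg : IntervalIntegrable g volume 0 L) (hu : ∀ x ∈ Icc 0 L, u x = C + ∫ s in 0..x, g s) :
    IsWeakDeriv 0 L u g := by
  have hU : uIcc 0 L = Icc 0 L := uIcc_of_le hL.le
  set U : ℝ → E := fun x => C + ∫ s in 0..x, g s with hUdef
  have hprim := absolutelyContinuousOnInterval_integral hg (c := 0) left_mem_uIcc
  have hUac : AbsolutelyContinuousOnInterval U 0 L :=
    hprim.of_dist_le fun x _ y _ => by simp [hUdef]
  have hUd : ∀ᵐ x, x ∈ uIcc 0 L → HasDerivAt U (g x) x := by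
    filter_upwards [hg.ae_hasDerivAt_integral] with x hx hx'
    exact (hx hx' 0 left_mem_uIcc).const_add C
  have huc : ContinuousOn u (Icc 0 L) := by
    have := hUac.continuousOn
    rw [hU] at this
    exact this.congr hu
  refine ⟨(huc.mono Ioo_subset_Icc_self).locallyIntegrableOn measurableSet_Ioo,
    (((intervalIntegrable_iff_integrableOn_Ioo_of_le hL.le).1 hg)).locallyIntegrableOn,
    fun φ h1 h2 h3 => ?_⟩
  have hφac : AbsolutelyContinuousOnInterval φ 0 L :=
    ((h1.of_le (by simp)).contDiffOn (s := uIcc 0 L)).absolutelyContinuousOnInterval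
  have hφ1 : Differentiable ℝ φ := h1.differentiable (by simp)
  have hφ'c : Continuous (deriv φ) := h1.continuous_deriv (by simp)
  have hI1 : IntervalIntegrable (fun s => φ s • g s) volume 0 L :=
    hg.continuousOn_smul h1.continuous.continuousOn
  have hI2 : IntervalIntegrable (fun s => deriv φ s • U s) volume 0 L :=
    (hφ'c.continuousOn.smul hUac.continuousOn).intervalIntegrable
  have key := integral_eq_sub_of_absolutelyContinuous (hφac.smul hUac)
    (f' := fun s => φ s • g s + deriv φ s • U s) (by
      filter_upwards [hUd] with x hx hx'
      exact (hφ1 x).hasDerivAt.smul (hx hx')) (hI1.add hI2)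
    (x := 0) (y := L) left_mem_uIcc right_mem_uIcc
  have hz : ∀ x, x ∉ Ioo 0 L → φ x = 0 := fun x hx =>
    image_eq_zero_of_notMem_tsupport fun h => hx (h3 h)
  rw [intervalIntegral.integral_add hI1 hI2] at key
  simp only [Pi.smul_apply', hz 0 (by simp), hz L (by simp), zero_smul, sub_zero] at key
  rw [intervalIntegral.integral_of_le hL.le, intervalIntegral.integral_of_le hL.le,
    integral_Ioc_eq_integral_Ioo, integral_Ioc_eq_integral_Ioo] at key
  rw [← eq_neg_iff_add_eq_zero.2 ((add_comm _ _).trans key)]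
  exact setIntegral_congr_fun measurableSet_Ioo fun s hs => by
    simp only [hUdef, hu s (Ioo_subset_Icc_self hs)]

/-- A test function with vanishing integral is the derivative of a test function. -/
lemma exists_test_primitive {L : ℝ} {ψ : ℝ → ℝ} (h1 : ContDiff ℝ ((⊤ : ℕ∞) : WithTop ℕ∞) ψ)
    (h2 : HasCompactSupport ψ) (h3 : tsupport ψ ⊆ Ioo 0 L) (h0 : ∫ s, ψ s = 0) :
    ∃ φ : ℝ → ℝ, ContDiff ℝ ((⊤ : ℕ∞) : WithTop ℕ∞) φ ∧ HasCompactSupport φ ∧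
      tsupport φ ⊆ Ioo 0 L ∧ deriv φ = ψ := by
  rcases (tsupport ψ).eq_empty_or_nonempty with he | hne
  · have : ψ = 0 := tsupport_eq_empty_iff.1 he
    exact ⟨0, contDiff_const, HasCompactSupport.zero, by simp, by simp [this]⟩
  have hK : IsCompact (tsupport ψ) := h2
  obtain ⟨α, hα, hα'⟩ := hK.exists_isLeast hne
  obtain ⟨β, hβ, hβ'⟩ := hK.exists_isGreatest hne
  set φ : ℝ → ℝ := fun x => ∫ s in 0..x, ψ s with hφ
  have hd : ∀ x, HasDerivAt φ (ψ x) x := fun x =>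
    (h1.continuous.integral_hasStrictDerivAt 0 x).hasDerivAt
  have hd' : deriv φ = ψ := funext fun x => (hd x).deriv
  have hz : ∀ x, x ∉ Icc α β → ψ x = 0 := fun x hx =>
    image_eq_zero_of_notMem_tsupport fun h => hx ⟨hα' h, hβ' h⟩
  -- Left of `α` nothing has been integrated; right of `β` the primitive equals the full integral,
  -- which is zero.
  have hsupp : ∀ x, x ∉ Icc α β → φ x = 0 := by
    intro x hx
    rcases lt_or_ge x α with h | h
    · refine (intervalIntegral.integral_congr (g := fun _ => (0 : ℝ)) fun s hs => ?_).trans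
        (by simp)
      refine hz s fun hs' => ?_
      have := hs.2.trans_lt (max_lt (h3 hα).1 h)
      exact absurd hs'.1 (not_le.2 this)
    · have hx' : β < x := by
        by_contra hle; exact hx ⟨h, not_lt.1 hle⟩
      refine Eq.trans ?_ h0
      refine intervalIntegral.integral_eq_integral_of_support_subset fun s hs => ?_
      have := subset_tsupport ψ hs
      exact ⟨(h3 this).1, (hβ' this).trans hx'.le⟩
  have hts : tsupport φ ⊆ Icc α β :=
    closure_minimal (fun x hx => by by_contra h; exact hx (hsupp x h)) isClosed_Icc
  refine ⟨φ, ?_, HasCompactSupport.of_support_subset_isCompact isCompact_Icc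
    ((subset_tsupport φ).trans hts), hts.trans fun x hx => ⟨(h3 hα).1.trans_le hx.1,
      hx.2.trans_lt (h3 hβ).2⟩, hd'⟩
  exact contDiff_infty_iff_deriv.2 ⟨fun x => (hd x).differentiableAt, hd' ▸ h1⟩

/-- The lemma of du Bois-Reymond. -/
lemma exists_ae_eq_const [CompleteSpace E] {L : ℝ} (hL : 0 < L) {f : ℝ → E}
    (hf : LocallyIntegrableOn f (Ioo 0 L) volume)
    (h : ∀ φ : ℝ → ℝ, ContDiff ℝ ((⊤ : ℕ∞) : WithTop ℕ∞) φ → HasCompactSupport φ →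
      tsupport φ ⊆ Ioo 0 L → ∫ s in Ioo 0 L, deriv φ s • f s = 0) :
    ∃ C : E, f =ᵐ[volume.restrict (Ioo 0 L)] fun _ => C := by
  -- A bump of integral one inside (0, L). Subtracting m η from ψ, where m is the integral of ψ,
  -- makes it the derivative of a test function, and the constant is ∫ η f.
  let B : ContDiffBump (L / 2) := ⟨L / 8, L / 4, by linarith, by linarith⟩
  set η : ℝ → ℝ := B.normed volume with hη
  have hη1 : ContDiff ℝ ((⊤ : ℕ∞) : WithTop ℕ∞) η := B.contDiff_normed
  have hη2 : HasCompactSupport η := B.hasCompactSupport_normed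
  have hη3 : tsupport η ⊆ Ioo 0 L := by
    rw [hη, B.tsupport_normed_eq, Real.closedBall_eq_Icc]
    intro x hx
    have h1 : L / 2 - L / 4 ≤ x := hx.1
    have h2 : x ≤ L / 2 + L / 4 := hx.2
    exact ⟨by linarith, by linarith⟩
  have hη0 : ∫ s, η s = 1 := B.integral_normed
  have hC : LocallyIntegrableOn (fun _ : ℝ => ∫ s in Ioo 0 L, η s • f s) (Ioo 0 L) volume :=
    continuousOn_const.locallyIntegrableOn measurableSet_Ioo
  refine ⟨∫ s in Ioo 0 L, η s • f s, ae_eq_of_forall_integral_smul_eq hf hC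
    fun ψ h1 h2 h3 => ?_⟩
  have hψi : Integrable ψ volume := h1.continuous.integrable_of_hasCompactSupport h2
  have hηi : Integrable η volume := hη1.continuous.integrable_of_hasCompactSupport hη2
  set m := ∫ s, ψ s with hm
  have hts : tsupport (fun s => ψ s - m * η s) ⊆ tsupport ψ ∪ tsupport η :=
    closure_minimal (fun x hx => by
      by_contra hn
      rw [mem_union, not_or] at hn
      exact hx (by simp [image_eq_zero_of_notMem_tsupport hn.1,
        image_eq_zero_of_notMem_tsupport hn.2]))
      ((isClosed_tsupport _).union (isClosed_tsupport _))
  obtain ⟨φ, k1, k2, k3, k4⟩ := exists_test_primitive (L := L) (ψ := fun s => ψ s - m * η s)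
    (h1.sub (contDiff_const.mul hη1))
    (HasCompactSupport.of_support_subset_isCompact (h2.isCompact.union hη2.isCompact)
      ((subset_tsupport _).trans hts))
    (hts.trans (union_subset h3 hη3))
    (by rw [integral_sub hψi (hηi.const_mul m), integral_const_mul, hη0, mul_one, sub_self])
  have h4 := h φ k1 k2 k3
  rw [k4] at h4
  have i1 := (integrable_smul_of_tsupport_subset h1.continuous h2 h3 hf).integrableOn
    (s := Ioo 0 L)
  have i2 := (integrable_smul_of_tsupport_subset hη1.continuous hη2 hη3 hf).integrableOn
    (s := Ioo 0 L)
  simp only [sub_smul, mul_smul] at h4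
  rw [integral_sub i1 (show IntegrableOn (fun s => m • η s • f s) (Ioo 0 L) volume from i2.smul m),
    sub_eq_zero, integral_smul] at h4
  rw [h4, setIntegral_smul_of_tsupport_subset (φ := ψ) h3, integral_smul_const]

/-- The primitive of `g` has the same weak derivative as `u`, so their difference is constant by du
Bois-Reymond. -/
lemma IsWeakDeriv.exists_ae_eq_integral [CompleteSpace E] {L : ℝ} (hL : 0 < L) {u g : ℝ → E}
    (h : IsWeakDeriv 0 L u g) (hg : IntervalIntegrable g volume 0 L) :
    ∃ C : E, u =ᵐ[volume.restrict (Ioo 0 L)] fun x => C + ∫ s in 0..x, g s := by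
  have hw : IsWeakDeriv 0 L (fun x => ∫ s in 0..x, g s) g :=
    isWeakDeriv_of_eq_integral hL hg (C := 0) fun x _ => by simp
  obtain ⟨C, hC⟩ := exists_ae_eq_const hL (h.1.sub hw.1) fun φ h1 h2 h3 => by
    have hφ'c : Continuous (deriv φ) := h1.continuous_deriv (by simp)
    have hs : tsupport (deriv φ) ⊆ Ioo 0 L := (closure_minimal support_deriv_subset
      (isClosed_tsupport φ)).trans h3
    simp only [Pi.sub_apply, smul_sub]
    rw [integral_sub
      (integrable_smul_of_tsupport_subset hφ'c h2.deriv hs h.1).integrableOn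
      (integrable_smul_of_tsupport_subset hφ'c h2.deriv hs hw.1).integrableOn,
      h.2.2 φ h1 h2 h3, hw.2.2 φ h1 h2 h3, sub_self]
  refine ⟨C, ?_⟩
  filter_upwards [hC] with x hx
  rw [← hx, Pi.sub_apply, sub_add_cancel]

end WeakDerivative

/-! ### The tangent and the Sobolev space W^{2,p}. -/

section Sobolev

variable {E : Type*} [NormedAddCommGroup E] [InnerProductSpace ℝ E] [FiniteDimensional ℝ E]
  {c τ w : ℝ → E} {p L : ℝ}

lemma memLp_of_continuousOn {q : ℝ≥0∞} {u : ℝ → E} (hu : ContinuousOn u (Icc 0 L)) :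
    MemLp u q (volume.restrict (Ioo 0 L)) := by
  obtain ⟨C, hC⟩ := isCompact_Icc.exists_bound_of_continuousOn hu
  refine MemLp.of_bound ((hu.mono Ioo_subset_Icc_self).aestronglyMeasurable measurableSet_Ioo) C ?_
  rw [ae_restrict_iff' measurableSet_Ioo]
  exact .of_forall fun x hx => hC x (Ioo_subset_Icc_self hx)

namespace IsTangent

lemma intervalIntegrable (h : IsTangent p L c τ w) (hp : 1 < p) (hL : 0 < L) :
    IntervalIntegrable w volume 0 L :=
  intervalIntegrable_of_memLp hp hL h.memLp

lemma continuousOn (h : IsTangent p L c τ w) (hp : 1 < p) (hL : 0 < L) :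
    ContinuousOn τ (Icc 0 L) := by
  have := (absolutelyContinuousOnInterval_integral (h.intervalIntegrable hp hL) (c := 0)
    left_mem_uIcc).continuousOn
  rw [uIcc_of_le hL.le] at this
  exact (continuousOn_const.add this).congr h.eq_integral

lemma integral_eq (h : IsTangent p L c τ w) (hp : 1 < p) (hL : 0 < L) {x y : ℝ}
    (hx : x ∈ Icc 0 L) (hy : y ∈ Icc 0 L) (hxy : x ≤ y) : ∫ s in x..y, τ s = c y - c x := by
  have := FiniteDimensional.complete ℝ E
  have hsub : Icc x y ⊆ Icc 0 L := Icc_subset_Icc hx.1 hy.2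
  refine intervalIntegral.integral_eq_sub_of_hasDerivAt_of_le hxy
    (fun z hz => ((h.hasDeriv z (hsub hz)).continuousWithinAt.mono hsub))
    (fun z hz => (h.hasDeriv z (hsub (Ioo_subset_Icc_self hz))).hasDerivAt
      (Icc_mem_nhds (hx.1.trans_lt hz.1) (hz.2.trans_le hy.2))) ?_
  exact ((h.continuousOn hp hL).mono (by rwa [uIcc_of_le hxy])).intervalIntegrable

lemma isWeakDeriv_tangent (h : IsTangent p L c τ w) (hp : 1 < p) (hL : 0 < L) :
    IsWeakDeriv 0 L c τ := by
  have := FiniteDimensional.complete ℝ E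
  refine isWeakDeriv_of_eq_integral hL (C := c 0)
    ((uIcc_of_le hL.le ▸ h.continuousOn hp hL : ContinuousOn τ (uIcc 0 L)).intervalIntegrable)
    fun x hx => ?_
  rw [h.integral_eq hp hL (left_mem_Icc.2 hL.le) hx hx.1]
  abel

lemma isWeakDeriv_curvature (h : IsTangent p L c τ w) (hp : 1 < p) (hL : 0 < L) :
    IsWeakDeriv 0 L τ w := by
  have := FiniteDimensional.complete ℝ E
  exact isWeakDeriv_of_eq_integral hL (h.intervalIntegrable hp hL) h.eq_integral

lemma memW2 (h : IsTangent p L c τ w) (hp : 1 < p) (hL : 0 < L) : MemW2 p 0 L c :=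
  ⟨memLp_of_continuousOn fun z hz => (h.hasDeriv z hz).continuousWithinAt, τ, w,
    h.isWeakDeriv_tangent hp hL, h.isWeakDeriv_curvature hp hL,
    memLp_of_continuousOn (h.continuousOn hp hL), h.memLp⟩

lemma ae_eq (h : IsTangent p L c τ w) (hp : 1 < p) (hL : 0 < L) {v' w' : ℝ → E}
    (hv : IsWeakDeriv 0 L c v') (hw : IsWeakDeriv 0 L v' w') :
    w =ᵐ[volume.restrict (Ioo 0 L)] w' := by
  have := FiniteDimensional.complete ℝ E
  exact (h.isWeakDeriv_curvature hp hL).ae_eq hw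
    ((h.isWeakDeriv_tangent hp hL).ae_eq hv (ae_eq_refl c))

lemma lintegral_eq (h : IsTangent p L c τ w) (hp : 1 < p) (hL : 0 < L) {v' w' : ℝ → E}
    (hv : IsWeakDeriv 0 L c v') (hw : IsWeakDeriv 0 L v' w') :
    ∫⁻ s in Ioo 0 L, ‖w s‖ₑ ^ p = ∫⁻ s in Ioo 0 L, ‖w' s‖ₑ ^ p := by
  refine lintegral_congr_ae ?_
  filter_upwards [h.ae_eq hp hL hv hw] with x hx
  rw [hx]

end IsTangent

/-- The first weak derivative has a continuous representative, a primitive of the second one. It is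
the true one-sided derivative at the end points, so the common `e` makes it close up. -/
lemma MemW2.exists_isTangent (hp : 1 < p) (hL : 0 < L) (hcont : ContinuousOn c (Icc 0 L))
    (h : MemW2 p 0 L c) {e : E} (h0 : HasDerivWithinAt c e (Icc 0 L) 0)
    (h1 : HasDerivWithinAt c e (Icc 0 L) L) : ∃ τ w : ℝ → E, IsTangent p L c τ w := by
  have := FiniteDimensional.complete ℝ E
  have hu : uIcc 0 L = Icc 0 L := uIcc_of_le hL.le
  obtain ⟨-, v, w, hv, hw, hvp, hwp⟩ := h
  have hwi := intervalIntegrable_of_memLp hp hL hwp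
  have hvi := intervalIntegrable_of_memLp hp hL hvp
  obtain ⟨C, hC⟩ := hw.exists_ae_eq_integral hL hwi
  obtain ⟨C', hC'⟩ := hv.exists_ae_eq_integral hL hvi
  set τ : ℝ → E := fun x => C + ∫ s in 0..x, w s with hτ
  have hτc : ContinuousOn τ (Icc 0 L) := by
    have := (absolutelyContinuousOnInterval_integral hwi (c := 0) left_mem_uIcc).continuousOn
    rw [hu] at this
    exact continuousOn_const.add this
  have hvc := (absolutelyContinuousOnInterval_integral hvi (c := 0) left_mem_uIcc).continuousOn
  rw [hu] at hvc
  -- Equality almost everywhere of continuous functions extends to the whole closed interval.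
  have hceq : EqOn c (fun x => C' + ∫ s in 0..x, v s) (Icc 0 L) := by
    refine Measure.eqOn_Icc_of_ae_eq volume hL.ne ?_ hcont (continuousOn_const.add hvc)
    rwa [← Measure.restrict_congr_set Ioo_ae_eq_Icc]
  have hC'0 : C' = c 0 := by
    have := hceq (left_mem_Icc.2 hL.le)
    simpa using this.symm
  have hcI : ∀ x ∈ Icc 0 L, c x = c 0 + ∫ s in 0..x, τ s := by
    intro x hx
    rw [hceq hx, hC'0]
    change c 0 + ∫ s in 0..x, v s = _
    congr 1
    rw [intervalIntegral.integral_of_le hx.1, intervalIntegral.integral_of_le hx.1,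
      integral_Ioc_eq_integral_Ioo, integral_Ioc_eq_integral_Ioo]
    exact integral_congr_ae (ae_restrict_of_ae_restrict_of_subset (Ioo_subset_Ioo_right hx.2) hC)
  have hder : ∀ x ∈ Icc 0 L, HasDerivWithinAt c (τ x) (Icc 0 L) x := fun x hx =>
    hasDerivWithinAt_of_eq_integral hL hτc hcI hx
  have hun : ∀ x ∈ Icc 0 L, HasDerivWithinAt c e (Icc 0 L) x → τ x = e := fun x hx hx' => by
    rw [← (hder x hx).derivWithin (uniqueDiffOn_Icc hL x hx),
      hx'.derivWithin (uniqueDiffOn_Icc hL x hx)]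
  refine ⟨τ, w, hder, fun x _ => by simp [hτ], ?_, hwp⟩
  rw [hun 0 (left_mem_Icc.2 hL.le) h0, hun L (right_mem_Icc.2 hL.le) h1]

end Sobolev

/-! ### Upper bound: a single corner, and the sum of second differences. -/

section UpperBound

/-- Hölder's inequality for the splitting f g = f^(1/q) · (f^(1/p) g), with the weight f. -/
lemma rpow_lintegral_mul_le {α : Type*} [MeasurableSpace α] {μ : Measure α} {p : ℝ} (hp : 1 < p)
    {f g : α → ℝ≥0∞} (hf : AEMeasurable f μ) (hg : AEMeasurable g μ) :
    (∫⁻ s, f s * g s ∂μ) ^ p ≤ (∫⁻ s, f s ∂μ) ^ (p - 1) * ∫⁻ s, f s * g s ^ p ∂μ := by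
  have hp0 : 0 < p := by linarith
  set q := p.conjExponent with hq
  have hpq : p.HolderConjugate q := Real.HolderConjugate.conjExponent hp
  have hq0 : 0 < q := hpq.symm.pos
  have h := ENNReal.lintegral_mul_le_Lp_mul_Lq μ hpq.symm (f := fun s => f s ^ (1 / q))
    (g := fun s => f s ^ (1 / p) * g s) (hf.pow_const _) ((hf.pow_const _).mul hg)
  have h1 : ∀ s, ((fun s => f s ^ (1 / q)) * fun s => f s ^ (1 / p) * g s) s = f s * g s := by
    intro s
    have := hpq.symm.inv_add_inv_eq_one
    rw [Pi.mul_apply, ← mul_assoc, ← ENNReal.rpow_add_of_nonneg _ _ (by positivity)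
      (by positivity), one_div, one_div, this, ENNReal.rpow_one]
  have h2 : ∀ s, (f s ^ (1 / q)) ^ q = f s := fun s => by
    rw [← ENNReal.rpow_mul, one_div, inv_mul_cancel₀ hq0.ne', ENNReal.rpow_one]
  have h3 : ∀ s, (f s ^ (1 / p) * g s) ^ p = f s * g s ^ p := fun s => by
    rw [ENNReal.mul_rpow_of_nonneg _ _ hp0.le, ← ENNReal.rpow_mul, one_div,
      inv_mul_cancel₀ hp0.ne', ENNReal.rpow_one]
  simp only [h1, h2, h3] at h
  refine (ENNReal.rpow_le_rpow h hp0.le).trans_eq ?_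
  rw [ENNReal.mul_rpow_of_nonneg _ _ hp0.le, ← ENNReal.rpow_mul, ← ENNReal.rpow_mul, one_div,
    one_div, inv_mul_cancel₀ hp0.ne', ENNReal.rpow_one]
  congr 2
  have := hpq.symm.inv_add_inv_eq_one
  have h4 : q⁻¹ = 1 - p⁻¹ := by linarith
  rw [h4]
  field_simp

lemma lintegral_ofReal_sub_left {a b : ℝ} (hab : a ≤ b) :
    ∫⁻ s in Ioo a b, ENNReal.ofReal (s - a) = ENNReal.ofReal ((b - a) ^ 2 / 2) := by
  rw [← ofReal_integral_eq_lintegral_ofReal, ← integral_Ioc_eq_integral_Ioo,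
    ← intervalIntegral.integral_of_le hab]
  · congr 1
    rw [intervalIntegral.integral_comp_sub_right (fun x => x), integral_id]
    ring
  · exact (((continuous_id.sub continuous_const).integrableOn_Icc (a := a) (b := b)).mono_set
      Ioo_subset_Icc_self)
  · rw [EventuallyLE, ae_restrict_iff' measurableSet_Ioo]
    exact .of_forall fun s hs => sub_nonneg.2 hs.1.le

lemma lintegral_ofReal_sub_right {a b : ℝ} (hab : a ≤ b) :
    ∫⁻ s in Ioo a b, ENNReal.ofReal (b - s) = ENNReal.ofReal ((b - a) ^ 2 / 2) := by
  rw [← ofReal_integral_eq_lintegral_ofReal, ← integral_Ioc_eq_integral_Ioo,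
    ← intervalIntegral.integral_of_le hab]
  · congr 1
    rw [intervalIntegral.integral_comp_sub_left (fun x => x), integral_id]
    ring
  · exact (((continuous_const.sub continuous_id).integrableOn_Icc (a := a) (b := b)).mono_set
      Ioo_subset_Icc_self)
  · rw [EventuallyLE, ae_restrict_iff' measurableSet_Ioo]
    exact .of_forall fun s hs => sub_nonneg.2 hs.2.le

variable {E : Type*} [NormedAddCommGroup E] [InnerProductSpace ℝ E]

/-- The law of cosines reads ‖v - u‖² = (‖u‖ - ‖v‖)² + 4 ‖u‖ ‖v‖ sin²(θ/2). -/
lemma two_sin_half_angle_mul_min_le (u v : E) :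
    2 * Real.sin (InnerProductGeometry.angle u v / 2) * min ‖u‖ ‖v‖ ≤ ‖v - u‖ := by
  set θ := InnerProductGeometry.angle u v with hθ
  have h0 := InnerProductGeometry.angle_nonneg u v
  have h1 := InnerProductGeometry.angle_le_pi u v
  have hs : 0 ≤ Real.sin (θ / 2) := Real.sin_nonneg_of_nonneg_of_le_pi (by linarith) (by linarith)
  refine abs_le_of_sq_le_sq' ?_ (norm_nonneg _) |>.2
  have hcos : Real.cos θ = 1 - 2 * Real.sin (θ / 2) ^ 2 := by
    have := Real.cos_sq' (θ / 2)
    have h2 := Real.cos_two_mul (θ / 2)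
    rw [mul_div_cancel₀ _ (two_ne_zero)] at h2
    rw [h2, this]; ring
  have hin : inner ℝ v u = ‖u‖ * ‖v‖ * (1 - 2 * Real.sin (θ / 2) ^ 2) := by
    rw [← hcos, hθ, real_inner_comm, mul_comm, InnerProductGeometry.cos_angle_mul_norm_mul_norm]
  rw [@norm_sub_sq_real, hin]
  have hm : min ‖u‖ ‖v‖ ^ 2 ≤ ‖u‖ * ‖v‖ := by
    rw [sq]
    exact mul_le_mul (min_le_left _ _) (min_le_right _ _) (le_min (norm_nonneg _) (norm_nonneg _))
      (norm_nonneg _)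
  nlinarith [sq_nonneg (‖u‖ - ‖v‖), mul_le_mul_of_nonneg_left hm (sq_nonneg (Real.sin (θ / 2)))]

/-- The factor that compares the energy of a corner with that of the corresponding second
difference, when the edges deviate by the relative amount `ω` from the tangents. -/
noncomputable def distortion (p ω : ℝ) : ℝ :=
  ((1 - ω) ^ (2 * p - 1))⁻¹ * ((1 - (ω / (1 - ω)) ^ 2) ^ p)⁻¹

lemma exists_distortion_le (p : ℝ) {ε : ℝ} (hε : 0 < ε) :
    ∃ ω, 0 < ω ∧ ω < 1 / 2 ∧ distortion p ω ≤ 1 + ε := by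
  have hc : ContinuousAt (distortion p) 0 := by
    unfold distortion
    refine ContinuousAt.mul (ContinuousAt.inv₀ (ContinuousAt.rpow_const (by fun_prop)
      (Or.inl (by simp))) (by simp)) (ContinuousAt.inv₀ (ContinuousAt.rpow_const ?_
      (Or.inl (by simp))) (by simp))
    exact continuousAt_const.sub (((continuousAt_id).div (continuousAt_const.sub continuousAt_id)
      (by simp)).pow 2)
  have h0 : distortion p 0 = 1 := by simp [distortion]
  have h1 : ∀ᶠ ω in 𝓝 (0 : ℝ), distortion p ω < 1 + ε :=
    hc.tendsto.eventually (gt_mem_nhds (by rw [h0]; linarith))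
  have h2 : ∀ᶠ ω in 𝓝[>] (0 : ℝ), ω < 1 / 2 :=
    nhdsWithin_le_nhds (gt_mem_nhds (by norm_num))
  have h3 : ∀ᶠ ω in 𝓝[>] (0 : ℝ), distortion p ω < 1 + ε := nhdsWithin_le_nhds h1
  obtain ⟨ω, ⟨h3, h4⟩, h5⟩ := ((h3.and h2).and self_mem_nhdsWithin).exists
  exact ⟨ω, h5, h4, h3.le⟩

/-- Nearly equal edges meet at a small angle, for which θ and 2 tan(θ/2) are at most about ‖v - u‖ /
r, and r is nearly δ or larger. The number y = ω / (1 - ω) bounds sin(θ/2), and ω < 1/2 makes it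
less than one. -/
lemma corner_le {p δ ω : ℝ} (hp : 1 < p) (hδ : 0 < δ) (hω0 : 0 < ω) (hω : ω < 1 / 2) {u v : E}
    (hu : (1 - ω) * δ ≤ ‖u‖) (hv : (1 - ω) * δ ≤ ‖v‖) (huv : ‖v - u‖ ≤ 2 * ω * δ) :
    InnerProductGeometry.angle u v ≠ Real.pi ∧
    InnerProductGeometry.angle u v *
      (Real.tan (InnerProductGeometry.angle u v / 2) / (min ‖u‖ ‖v‖ / 2)) ^ (p - 1) ≤
      distortion p ω * (‖v - u‖ ^ p / δ ^ (2 * p - 1)) := by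
  have hsin := two_sin_half_angle_mul_min_le u v
  have h0 := InnerProductGeometry.angle_nonneg u v
  have h1 := InnerProductGeometry.angle_le_pi u v
  set θ := InnerProductGeometry.angle u v with hθ
  set r := min ‖u‖ ‖v‖ with hr
  have hrδ : (1 - ω) * δ ≤ r := le_min hu hv
  have hω1 : 0 < 1 - ω := by linarith
  have hr0 : 0 < r := lt_of_lt_of_le (by positivity) hrδ
  set y := ω / (1 - ω) with hy
  have hy0 : 0 ≤ y := by positivity
  have hy1 : y < 1 := by rw [hy, div_lt_one hω1]; linarith
  have hy2 : 0 < 1 - y ^ 2 := by nlinarith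
  have hs0 : 0 ≤ Real.sin (θ / 2) :=
    Real.sin_nonneg_of_nonneg_of_le_pi (by linarith) (by linarith)
  have hsy : Real.sin (θ / 2) ≤ y := by
    rw [hy, le_div_iff₀ hω1]
    have h2 : 2 * Real.sin (θ / 2) * ((1 - ω) * δ) ≤ 2 * ω * δ :=
      (mul_le_mul_of_nonneg_left hrδ (by positivity)).trans (hsin.trans huv)
    by_contra hlt
    nlinarith [mul_pos (sub_pos.2 (not_le.1 hlt)) hδ]
  have hπ : θ ≠ Real.pi := by
    intro h
    rw [h, Real.sin_pi_div_two] at hsy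
    linarith
  refine ⟨hπ, ?_⟩
  have hlt : θ / 2 < Real.pi / 2 := by
    have := lt_of_le_of_ne h1 hπ
    linarith
  have hcos0 : 0 < Real.cos (θ / 2) :=
    Real.cos_pos_of_mem_Ioo ⟨by linarith [Real.pi_pos], hlt⟩
  -- The cosine lies in [0, 1], so it is at least its square 1 - sin².
  have hcos : 1 - y ^ 2 ≤ Real.cos (θ / 2) := by
    have h2 := Real.sin_sq_add_cos_sq (θ / 2)
    have h3 := Real.cos_le_one (θ / 2)
    nlinarith
  set T := Real.tan (θ / 2) with hT
  have hθT : θ / 2 ≤ T := Real.le_tan (by linarith) hlt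
  have hT0 : 0 ≤ T := le_trans (by linarith) hθT
  have hTle : 2 * T ≤ ‖v - u‖ / (r * (1 - y ^ 2)) := by
    rw [le_div_iff₀ (by positivity)]
    refine le_trans ?_ hsin
    have h2 : T * (1 - y ^ 2) ≤ Real.sin (θ / 2) := by
      have : T * Real.cos (θ / 2) = Real.sin (θ / 2) := Real.tan_mul_cos hcos0.ne'
      rw [← this]
      exact mul_le_mul_of_nonneg_left hcos hT0
    nlinarith
  have hD := norm_nonneg (v - u)
  calc θ * (T / (r / 2)) ^ (p - 1) ≤ 2 * T * (T / (r / 2)) ^ (p - 1) := by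
        refine mul_le_mul_of_nonneg_right (by linarith) (by positivity)
    _ = 2 * T * (2 * T / r) ^ (p - 1) := by congr 2; field_simp
    _ ≤ ‖v - u‖ / (r * (1 - y ^ 2)) * (‖v - u‖ / (r * (1 - y ^ 2)) / r) ^ (p - 1) := by
        refine mul_le_mul hTle (Real.rpow_le_rpow (by positivity) ?_ (by linarith))
          (by positivity) (by positivity)
        gcongr
    _ = ‖v - u‖ ^ p / (r ^ (2 * p - 1) * (1 - y ^ 2) ^ p) := by
        rcases hD.eq_or_lt with h | h
        · rw [← h, Real.zero_rpow (by linarith)]; simp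
        have e1 : (2 * p - 1) = p + (p - 1) := by ring
        rw [e1, Real.rpow_add hr0, div_div, Real.div_rpow hD (by positivity),
          Real.mul_rpow (by positivity) hr0.le, Real.mul_rpow hr0.le hy2.le,
          Real.rpow_sub_one h.ne', Real.rpow_sub_one hr0.ne', Real.rpow_sub_one hy2.ne']
        field_simp
    _ ≤ ‖v - u‖ ^ p / (((1 - ω) * δ) ^ (2 * p - 1) * (1 - y ^ 2) ^ p) := by
        have h2 : ((1 - ω) * δ) ^ (2 * p - 1) ≤ r ^ (2 * p - 1) :=
          Real.rpow_le_rpow (by positivity) hrδ (by linarith)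
        have h3 : 0 < ((1 - ω) * δ) ^ (2 * p - 1) := by positivity
        gcongr
    _ = distortion p ω * (‖v - u‖ ^ p / δ ^ (2 * p - 1)) := by
        rw [distortion, Real.mul_rpow hω1.le hδ.le, ← hy]
        have h3 : 0 < (1 - y ^ 2) ^ p := Real.rpow_pos_of_pos hy2 p
        generalize (1 - y ^ 2) ^ p = z at *
        field_simp

variable [FiniteDimensional ℝ E] {c τ w : ℝ → E} {p L : ℝ}

namespace IsTangent

lemma absolutelyContinuousOnInterval (h : IsTangent p L c τ w) (hp : 1 < p) (hL : 0 < L) :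
    AbsolutelyContinuousOnInterval τ 0 L := by
  refine (absolutelyContinuousOnInterval_integral (h.intervalIntegrable hp hL) (c := 0)
    left_mem_uIcc).of_dist_le fun x hx y hy => ?_
  rw [uIcc_of_le hL.le] at hx hy
  rw [h.eq_integral x hx, h.eq_integral y hy]
  simp

lemma ae_hasDerivAt (h : IsTangent p L c τ w) (hp : 1 < p) (hL : 0 < L) :
    ∀ᵐ x, x ∈ uIcc 0 L → HasDerivAt τ (w x) x := by
  have := FiniteDimensional.complete ℝ E
  have h0 : ∀ᵐ x : ℝ, x ≠ 0 := by simp [ae_iff, measure_singleton]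
  have h1 : ∀ᵐ x : ℝ, x ≠ L := by simp [ae_iff, measure_singleton]
  filter_upwards [(h.intervalIntegrable hp hL).ae_hasDerivAt_integral, h0, h1] with x hx h0 h1 hxL
  have hd := (hx hxL 0 left_mem_uIcc).const_add (τ 0)
  rw [uIcc_of_le hL.le] at hxL
  refine hd.congr_of_eventuallyEq ?_
  filter_upwards [Icc_mem_nhds (lt_of_le_of_ne hxL.1 h0.symm) (lt_of_le_of_ne hxL.2 h1)] with y hy
  exact h.eq_integral y hy

/-- Integration by parts against an affine function. -/
lemma integral_sub_smul (h : IsTangent p L c τ w) (hp : 1 < p) (hL : 0 < L) (d : ℝ) {a b : ℝ}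
    (ha : a ∈ Icc 0 L) (hb : b ∈ Icc 0 L) (hab : a ≤ b) :
    ∫ s in a..b, (s - d) • w s = (b - d) • τ b - (a - d) • τ a - (c b - c a) := by
  have := FiniteDimensional.complete ℝ E
  have hu : uIcc 0 L = Icc 0 L := uIcc_of_le hL.le
  have hsub : uIcc a b ⊆ uIcc 0 L := uIcc_subset_uIcc (hu ▸ ha) (hu ▸ hb)
  have hlin : AbsolutelyContinuousOnInterval (fun s : ℝ => s - d) 0 L :=
    ((contDiff_id.sub contDiff_const).contDiffOn (s := uIcc 0 L)).absolutelyContinuousOnInterval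
  have hτc : ContinuousOn τ (uIcc 0 L) := hu ▸ h.continuousOn hp hL
  have hI : IntervalIntegrable (fun s => (s - d) • w s) volume 0 L :=
    (h.intervalIntegrable hp hL).continuousOn_smul (by fun_prop)
  have key := integral_eq_sub_of_absolutelyContinuous
    (hlin.smul (h.absolutelyContinuousOnInterval hp hL))
    (f' := fun s => (s - d) • w s + (1 : ℝ) • τ s) (by
      filter_upwards [h.ae_hasDerivAt hp hL] with x hx hx'
      exact ((hasDerivAt_id x).sub_const d).smul (hx hx'))
    (hI.add (hτc.intervalIntegrable.smul (1 : ℝ))) (hu ▸ ha) (hu ▸ hb)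
  simp only [one_smul] at key
  rw [intervalIntegral.integral_add (hI.mono_set hsub) (hτc.mono hsub).intervalIntegrable,
    h.integral_eq hp hL ha hb hab] at key
  rw [eq_sub_iff_add_eq, key]
  rfl

lemma norm_sub_smul_le (h : IsTangent p L c τ w) (hp : 1 < p) (hL : 0 < L) {a b d ω : ℝ}
    (ha : a ∈ Icc 0 L) (hb : b ∈ Icc 0 L) (hab : a ≤ b)
    (hω : ∀ s ∈ Icc a b, ‖τ s - τ d‖ ≤ ω) : ‖(c b - c a) - (b - a) • τ d‖ ≤ ω * (b - a) := by
  have hu : uIcc 0 L = Icc 0 L := uIcc_of_le hL.le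
  have hτc : ContinuousOn τ (uIcc a b) := by
    rw [uIcc_of_le hab]
    exact (h.continuousOn hp hL).mono (Icc_subset_Icc ha.1 hb.2)
  rw [← h.integral_eq hp hL ha hb hab, ← intervalIntegral.integral_const,
    ← intervalIntegral.integral_sub hτc.intervalIntegrable (by simp)]
  have := intervalIntegral.norm_integral_le_of_norm_le_const (a := a) (b := b) (C := ω)
    (f := fun s => τ s - τ d) fun s hs => by
      rw [uIoc_of_le hab] at hs
      exact hω s (Ioc_subset_Icc_self hs)
  rwa [abs_of_nonneg (sub_nonneg.2 hab)] at this

end IsTangent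

/-- Weighted Hölder for one half of a tent, whose mass is (b - a)² / 2. -/
lemma rpow_enorm_integral_le (hp : 1 < p) (h : IsTangent p L c τ w) {a b : ℝ}
    (ha : 0 ≤ a) (hb : b ≤ L) (hab : a ≤ b) {f : ℝ → ℝ} (hf : Continuous f)
    (hf0 : ∀ s ∈ Ioo a b, 0 ≤ f s)
    (hfi : ∫⁻ s in Ioo a b, ENNReal.ofReal (f s) = ENNReal.ofReal ((b - a) ^ 2 / 2)) :
    ‖∫ s in a..b, f s • w s‖ₑ ^ p ≤ ENNReal.ofReal ((b - a) ^ 2 / 2) ^ (p - 1) *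
      ∫⁻ s in Ioo a b, ENNReal.ofReal (f s) * ‖w s‖ₑ ^ p := by
  have hm : AEStronglyMeasurable w (volume.restrict (Ioo a b)) :=
    h.memLp.1.mono_measure (Measure.restrict_mono (Ioo_subset_Ioo ha hb) le_rfl)
  refine le_trans (ENNReal.rpow_le_rpow ?_ (by linarith)) (hfi ▸ rpow_lintegral_mul_le hp
    (hf.measurable.ennreal_ofReal.aemeasurable) hm.enorm)
  rw [intervalIntegral.integral_of_le hab, integral_Ioc_eq_integral_Ioo]
  refine (enorm_integral_le_lintegral_enorm _).trans_eq ?_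
  refine setLIntegral_congr_fun measurableSet_Ioo fun s hs => ?_
  simp only [enorm_smul]
  rw [Real.enorm_of_nonneg (hf0 s hs)]

namespace InscribedPolygonal

variable {P : InscribedPolygonal c L}

/-- Consecutive edges share a vertex; at the base point this is where the closing of the tangent
enters. -/
lemma tangent_next (h : IsTangent p L c τ w) (k : Fin P.n) :
    τ (P.t (P.next k).castSucc) = τ (P.t k.succ) := by
  obtain ⟨k, hk⟩ := k
  rcases Nat.lt_or_ge (k + 1) P.n with hlt | hge
  · rw [P.next_of_lt hlt]; rfl
  · have he : k + 1 = P.n := by omega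
    rw [P.next_last he]
    have h0 : P.t (Fin.castSucc ⟨0, by omega⟩) = 0 := P.t_zero
    have h1 : (Fin.succ ⟨k, hk⟩ : Fin (P.n + 1)) = Fin.last P.n := by ext; exact he
    rw [h0, h1, P.t_last, h.closed]

lemma sum_lintegral {δ : ℝ} (hδ : 0 < δ) (hu : ∀ i, P.t i = (i : ℕ) * δ)
    (F : ℝ → ℝ≥0∞) :
    ∑ k : Fin P.n, ∫⁻ s in Ioo (P.t k.castSucc) (P.t k.succ), F s = ∫⁻ s in Ioo 0 L, F s := by
  have hn : (P.n : ℝ) * δ = L := by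
    have := hu (Fin.last P.n)
    rw [P.t_last] at this
    simpa using this.symm
  have hsum := lintegral_Ioo_nsmul hδ.le P.n F
  rw [hn] at hsum
  rw [hsum, ← Fin.sum_univ_eq_sum_range
    (fun k => ∫⁻ s in Ioo (k * δ) ((k + 1 : ℕ) * δ), F s) P.n]
  refine Finset.sum_congr rfl fun k _ => ?_
  rw [hu, hu]
  rfl

lemma sum_rpow_norm_edge_sub_le (hp : 1 < p) (hL : 0 < L) (h : IsTangent p L c τ w) {δ : ℝ}
    (hδ : 0 < δ) (hu : ∀ i, P.t i = (i : ℕ) * δ) :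
    ENNReal.ofReal (∑ k, ‖P.edge (P.next k) - P.edge k‖ ^ p) ≤
      ENNReal.ofReal (δ ^ (2 * p - 1)) * ∫⁻ s in Ioo 0 L, ‖w s‖ₑ ^ p := by
  set a : Fin P.n → ℝ := fun k => P.t k.castSucc with ha
  set b : Fin P.n → ℝ := fun k => P.t k.succ with hb
  have hlen : ∀ k, b k - a k = δ := fun k => by
    simp only [ha, hb, hu, Fin.val_succ, Fin.val_castSucc]; push_cast; ring
  have hab : ∀ k, a k ≤ b k := fun k => by linarith [hlen k]
  have ham : ∀ k, a k ∈ Icc 0 L := fun k => P.t_mem _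
  have hbm : ∀ k, b k ∈ Icc 0 L := fun k => P.t_mem _
  -- Integrating by parts on both edges leaves δ times the tangent at the common vertex, once with
  -- each sign.
  have hdiff : ∀ k, P.edge (P.next k) - P.edge k =
      (∫ s in a (P.next k)..b (P.next k), (b (P.next k) - s) • w s) +
        ∫ s in a k..b k, (s - a k) • w s := by
    intro k
    have h1 := h.integral_sub_smul hp hL (a k) (ham k) (hbm k) (hab k)
    have h2 := h.integral_sub_smul hp hL (b (P.next k)) (ham (P.next k)) (hbm (P.next k))
      (hab (P.next k))
    have h3 : ∫ s in a (P.next k)..b (P.next k), (b (P.next k) - s) • w s =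
        -∫ s in a (P.next k)..b (P.next k), (s - b (P.next k)) • w s := by
      rw [← intervalIntegral.integral_neg]
      refine intervalIntegral.integral_congr fun s _ => ?_
      simp only [← neg_smul, neg_sub]
    have h4 : τ (a (P.next k)) = τ (b k) := tangent_next h k
    have h5 : a (P.next k) - b (P.next k) = -δ := by linarith [hlen (P.next k)]
    rw [h3, h1, h2, h4, hlen k, h5]
    simp only [sub_self, zero_smul, edge, ha, hb, neg_smul]
    abel
  have hA : ∀ k, ‖∫ s in a k..b k, (s - a k) • w s‖ₑ ^ p ≤ ENNReal.ofReal (δ ^ 2 / 2) ^ (p - 1) *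
      ∫⁻ s in Ioo (a k) (b k), ENNReal.ofReal (s - a k) * ‖w s‖ₑ ^ p := fun k => by
    have := rpow_enorm_integral_le hp h (ham k).1 (hbm k).2 (hab k)
      (f := fun s => s - a k) (by fun_prop) (fun s hs => sub_nonneg.2 hs.1.le)
      (lintegral_ofReal_sub_left (hab k))
    rwa [hlen k] at this
  have hB : ∀ k, ‖∫ s in a k..b k, (b k - s) • w s‖ₑ ^ p ≤ ENNReal.ofReal (δ ^ 2 / 2) ^ (p - 1) *
      ∫⁻ s in Ioo (a k) (b k), ENNReal.ofReal (b k - s) * ‖w s‖ₑ ^ p := fun k => by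
    have := rpow_enorm_integral_le hp h (ham k).1 (hbm k).2 (hab k)
      (f := fun s => b k - s) (by fun_prop) (fun s hs => sub_nonneg.2 hs.2.le)
      (lintegral_ofReal_sub_right (hab k))
    rwa [hlen k] at this
  set A : Fin P.n → ℝ≥0∞ := fun k =>
    ∫⁻ s in Ioo (a k) (b k), ENNReal.ofReal (s - a k) * ‖w s‖ₑ ^ p with hAdef
  set B : Fin P.n → ℝ≥0∞ := fun k =>
    ∫⁻ s in Ioo (a k) (b k), ENNReal.ofReal (b k - s) * ‖w s‖ₑ ^ p with hBdef
  have hm : ∀ k, AEStronglyMeasurable w (volume.restrict (Ioo (a k) (b k))) := fun k =>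
    h.memLp.1.mono_measure (Measure.restrict_mono (Ioo_subset_Ioo (ham k).1 (hbm k).2) le_rfl)
  -- The ascending and the descending weight on one edge add up to the constant δ.
  have hAB : ∀ k, A k + B k =
      ENNReal.ofReal δ * ∫⁻ s in Ioo (a k) (b k), ‖w s‖ₑ ^ p := fun k => by
    rw [hAdef, hBdef, ← lintegral_add_left' (by
      exact (by fun_prop : Measurable fun s => ENNReal.ofReal (s - a k)).aemeasurable.mul
        ((hm k).enorm.pow_const p)), ← lintegral_const_mul'' _ ((hm k).enorm.pow_const p)]
    refine setLIntegral_congr_fun measurableSet_Ioo fun s hs => ?_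
    rw [← add_mul, ← ENNReal.ofReal_add (sub_nonneg.2 hs.1.le) (sub_nonneg.2 hs.2.le), ← hlen k]
    congr 2
    ring
  -- Convexity costs 2^(p-1), which cancels against the half mass: 2^(p-1) (δ²/2)^(p-1) = δ^(2p-2).
  -- So the constant stays sharp.
  have hterm : ∀ k, ENNReal.ofReal (‖P.edge (P.next k) - P.edge k‖ ^ p) ≤
      ENNReal.ofReal (δ ^ (2 * p - 2)) * (A k + B (P.next k)) := by
    intro k
    rw [← ENNReal.ofReal_rpow_of_nonneg (norm_nonneg _) (by linarith), ofReal_norm, hdiff k]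
    refine (ENNReal.rpow_le_rpow (enorm_add_le _ _) (by linarith)).trans ?_
    refine (ENNReal.rpow_add_le_mul_rpow_add_rpow _ _ hp.le).trans ?_
    refine (mul_le_mul_right (add_le_add (hB (P.next k)) (hA k)) _).trans_eq ?_
    rw [← mul_add, ← mul_assoc, add_comm (A k), ← ENNReal.mul_rpow_of_nonneg _ _ (by linarith)]
    congr 1
    have h2 : (2 : ℝ≥0∞) = ENNReal.ofReal 2 := by simp
    rw [h2, ← ENNReal.ofReal_mul (by norm_num), ENNReal.ofReal_rpow_of_nonneg (by positivity)
      (by linarith), mul_div_cancel₀ _ two_ne_zero, ← Real.rpow_natCast, ← Real.rpow_mul hδ.le]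
    congr 2
    push_cast
    ring
  rw [ENNReal.ofReal_sum_of_nonneg fun k _ => Real.rpow_nonneg (norm_nonneg _) _]
  refine (Finset.sum_le_sum fun k _ => hterm k).trans_eq ?_
  rw [← Finset.mul_sum, Finset.sum_add_distrib]
  -- Cyclic reindexing brings both half tents over the same edge together.
  have hrot : ∑ k, B (P.next k) = ∑ k, B k := Equiv.sum_comp (finRotate P.n) B
  rw [hrot, ← Finset.sum_add_distrib]
  simp only [hAB]
  rw [← Finset.mul_sum, sum_lintegral hδ hu, ← mul_assoc,
    ← ENNReal.ofReal_mul (by positivity)]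
  congr 2
  rw [show 2 * p - 1 = (2 * p - 2) + 1 by ring, Real.rpow_add hδ, Real.rpow_one]

end InscribedPolygonal

end UpperBound

/-! ### The p-curvature: recovery polygonals and equality of the bounds. -/

section Curvature

variable {E : Type*} [NormedAddCommGroup E] [InnerProductSpace ℝ E] [FiniteDimensional ℝ E]
  {c τ w : ℝ → E} {p L : ℝ}

namespace InscribedPolygonal

lemma modulus_le (hc : LipschitzOnWith 1 c (Icc 0 L)) {P : InscribedPolygonal c L} {δ : ℝ}
    (hδ : ∀ k : Fin P.n, P.t k.succ - P.t k.castSucc ≤ δ) : P.modulus ≤ ENNReal.ofReal δ := by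
  refine iSup_le fun k => Metric.ediam_le ?_
  have hsub : Icc (P.t k.castSucc) (P.t k.succ) ⊆ Icc 0 L :=
    Icc_subset_Icc (P.t_mem _).1 (P.t_mem _).2
  rintro _ ⟨x, hx, rfl⟩ _ ⟨y, hy, rfl⟩
  have h := hc (hsub hx) (hsub hy)
  rw [ENNReal.coe_one, one_mul] at h
  refine (h.trans (Metric.edist_le_ediam_of_mem hx hy)).trans ?_
  rw [Real.ediam_Icc]
  exact ENNReal.ofReal_le_ofReal (hδ k)

/-- A closed curve with tangent in `W^{1,p}` has inscribed polygonals of small modulus whose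
`p`-rotation hardly exceeds the energy of the curve. -/
theorem exists_pRotation_le (hp : 1 < p) (hL : 0 < L) (hc : HasUnitSpeedOn c (Icc 0 L))
    (h : IsTangent p L c τ w) {ε : ℝ} (hε : 0 < ε) :
    ∃ P : InscribedPolygonal c L, P.modulus ≤ ENNReal.ofReal ε ∧
      P.pRotation p ≤ ENNReal.ofReal (1 + ε) * ∫⁻ s in Ioo 0 L, ‖w s‖ₑ ^ p := by
  obtain ⟨ω, hω0, hω, hdist⟩ := exists_distortion_le p hε
  have hτc := h.continuousOn hp hL
  -- On intervals of length at most `d` the tangent varies by at most ω, so every edge deviates from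
  -- δ times a tangent by at most ω δ.
  obtain ⟨d, hd, hτd⟩ := Metric.uniformContinuousOn_iff_le.1
    (isCompact_Icc.uniformContinuousOn_of_continuous hτc) ω hω0
  obtain ⟨n, hn⟩ : ∃ n : ℕ, L / (n + 1 : ℕ) ≤ min d ε := by
    have h1 : Tendsto (fun n : ℕ => L / (n + 1 : ℕ)) atTop (𝓝 0) :=
      (tendsto_const_div_atTop_nhds_zero_nat L).comp (tendsto_add_atTop_nat 1)
    exact ((h1.eventually (gt_mem_nhds (lt_min hd hε))).exists).imp fun n hn => hn.le
  set δ := L / (n + 1 : ℕ) with hδdef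
  have hδ : 0 < δ := by positivity
  have hδL : (n + 1 : ℕ) * δ = L := by rw [hδdef]; field_simp
  have hnorm : ∀ x ∈ Icc 0 L, ‖τ x‖ = 1 := fun x hx =>
    norm_tangent_eq_one hL hc hτc h.hasDeriv hx
  have hclose : ∀ a ∈ Icc 0 L, ∀ b ∈ Icc 0 L, b - a = δ → ∀ x ∈ Icc a b,
      ‖(c b - c a) - δ • τ x‖ ≤ ω * δ := by
    intro a ha b hb hab x hx
    have hsub : Icc a b ⊆ Icc 0 L := Icc_subset_Icc ha.1 hb.2
    have := h.norm_sub_smul_le hp hL (d := x) (ω := ω) ha hb (by linarith) fun s hs => by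
      rw [← dist_eq_norm]
      refine hτd s (hsub hs) x (hsub hx) ?_
      rw [Real.dist_eq, abs_le]
      have := min_le_left d ε
      constructor <;> linarith [hs.1, hs.2, hx.1, hx.2]
    rwa [hab] at this
  have hlower : ∀ a ∈ Icc 0 L, ∀ b ∈ Icc 0 L, b - a = δ → (1 - ω) * δ ≤ ‖c b - c a‖ := by
    intro a ha b hb hab
    have h1 := hclose a ha b hb hab b (right_mem_Icc.2 (by linarith))
    have h2 : ‖δ • τ b‖ = δ := by rw [norm_smul, hnorm b hb, mul_one, Real.norm_of_nonneg hδ.le]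
    have h3 := norm_sub_norm_le (δ • τ b) (δ • τ b - (c b - c a))
    rw [sub_sub_cancel, norm_sub_rev, h2] at h3
    linarith
  have hmem : ∀ k : ℕ, k ≤ n + 1 → (k : ℝ) * δ ∈ Icc 0 L := fun k hk =>
    ⟨by positivity, hδL ▸ mul_le_mul_of_nonneg_right (by exact_mod_cast hk) hδ.le⟩
  have hstep : ∀ k : ℕ, ((k + 1 : ℕ) : ℝ) * δ - k * δ = δ := fun k => by push_cast; ring
  let P : InscribedPolygonal c L :=
    { n := n + 1
      t := fun i => (i : ℕ) * δ
      strictMono := fun i j hij => mul_lt_mul_of_pos_right (by exact_mod_cast hij) hδ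
      t_zero := by simp
      t_last := by simpa using hδL
      nondegenerate := fun i hi => by
        have h1 := hlower _ (hmem i (by omega)) _ (hmem (i + 1) (by omega)) (hstep i)
        have h2 : c ((i + 1 : ℕ) * δ) - c (i * δ) = 0 := sub_eq_zero.2 hi.symm
        rw [h2, norm_zero] at h1
        nlinarith }
  have hu : ∀ i, P.t i = (i : ℕ) * δ := fun _ => rfl
  have hlen : ∀ k : Fin P.n, P.t k.succ - P.t k.castSucc = δ := fun k => hstep k
  have hedge : ∀ k : Fin P.n, (1 - ω) * δ ≤ ‖P.edge k‖ := fun k =>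
    hlower _ (P.t_mem _) _ (P.t_mem _) (hlen k)
  -- Both edges are within ω δ of δ times the tangent at their common vertex.
  have hjump : ∀ k : Fin P.n, ‖P.edge (P.next k) - P.edge k‖ ≤ 2 * ω * δ := by
    intro k
    have h1 := hclose _ (P.t_mem k.castSucc) _ (P.t_mem k.succ) (hlen k) (P.t k.succ)
      (right_mem_Icc.2 (by linarith [hlen k]))
    have h2 := hclose _ (P.t_mem (P.next k).castSucc) _ (P.t_mem (P.next k).succ)
      (hlen (P.next k)) (P.t (P.next k).castSucc) (left_mem_Icc.2 (by linarith [hlen (P.next k)]))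
    rw [tangent_next h k] at h2
    have h3 := norm_sub_le (P.edge (P.next k) - δ • τ (P.t k.succ))
      (P.edge k - δ • τ (P.t k.succ))
    rw [sub_sub_sub_cancel_right] at h3
    simp only [edge] at h3 ⊢
    linarith
  have hcorner : ∀ k : Fin P.n, P.turningAngle k ≠ Real.pi ∧ P.cornerEnergy p k ≤
      distortion p ω * (‖P.edge (P.next k) - P.edge k‖ ^ p / δ ^ (2 * p - 1)) := fun k =>
    corner_le hp hδ hω0 hω (hedge k) (hedge (P.next k)) (hjump k)
  refine ⟨P, (modulus_le (lipschitzOnWith_of_unitSpeed hc) fun k => (hlen k).le).trans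
    (ENNReal.ofReal_le_ofReal (hn.trans (min_le_right _ _))), ?_⟩
  have hδp : 0 < δ ^ (2 * p - 1) := Real.rpow_pos_of_pos hδ _
  rw [P.pRotation_eq (by linarith) fun k => (hcorner k).1]
  calc ENNReal.ofReal (∑ k, P.cornerEnergy p k)
      ≤ ENNReal.ofReal ((1 + ε) / δ ^ (2 * p - 1) *
          ∑ k, ‖P.edge (P.next k) - P.edge k‖ ^ p) := by
        refine ENNReal.ofReal_le_ofReal ?_
        rw [Finset.mul_sum]
        refine Finset.sum_le_sum fun k _ => (hcorner k).2.trans ?_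
        have := Real.rpow_nonneg (norm_nonneg (P.edge (P.next k) - P.edge k)) p
        calc _ ≤ (1 + ε) * (‖P.edge (P.next k) - P.edge k‖ ^ p / δ ^ (2 * p - 1)) :=
              mul_le_mul_of_nonneg_right hdist (by positivity)
          _ = _ := by ring
    _ ≤ ENNReal.ofReal ((1 + ε) / δ ^ (2 * p - 1)) *
          (ENNReal.ofReal (δ ^ (2 * p - 1)) * ∫⁻ s in Ioo 0 L, ‖w s‖ₑ ^ p) := by
        rw [ENNReal.ofReal_mul (by positivity)]
        exact mul_le_mul_right (sum_rpow_norm_edge_sub_le hp hL h hδ hu) _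
    _ = _ := by
        rw [← mul_assoc, ← ENNReal.ofReal_mul (by positivity), div_mul_cancel₀ _ hδp.ne']

end InscribedPolygonal

theorem IsTangent.pCurvature_le (h : IsTangent p L c τ w) (hp : 1 < p) (hL : 0 < L)
    (hc : HasUnitSpeedOn c (Icc 0 L)) :
    pCurvature p L c ≤ ∫⁻ s in Ioo 0 L, ‖w s‖ₑ ^ p := by
  have hW := ((memLp_iff_lintegral hp).1 h.memLp).2
  have h0 : Tendsto (fun n : ℕ => (1 : ℝ) / ((n : ℝ) + 1)) atTop (𝓝 0) :=
    tendsto_one_div_add_atTop_nhds_zero_nat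
  choose P hP1 hP2 using fun n : ℕ => InscribedPolygonal.exists_pRotation_le hp hL hc h
    (Nat.one_div_pos_of_nat (α := ℝ) (n := n))
  have hmod : Tendsto (fun n => (P n).modulus) atTop (𝓝 0) := by
    refine tendsto_of_tendsto_of_tendsto_of_le_of_le tendsto_const_nhds ?_
      (fun _ => zero_le) hP1
    simpa using ENNReal.tendsto_ofReal h0
  refine (iInf₂_le P hmod).trans ((liminf_le_liminf (.of_forall hP2)).trans_eq ?_)
  refine Tendsto.liminf_eq ?_
  have h1 := ENNReal.Tendsto.mul_const (b := ∫⁻ s in Ioo 0 L, ‖w s‖ₑ ^ p)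
    (ENNReal.tendsto_ofReal (h0.const_add 1)) (Or.inr hW.ne)
  simpa using h1

/-- A liminf below `M` yields a subsequence with p-rotations below `M`, and its moduli still tend to
zero. -/
theorem exists_isTangent_of_liminf_lt (hp : 1 < p) (hL : 0 < L)
    (hc : HasUnitSpeedOn c (Icc 0 L)) {P : ℕ → InscribedPolygonal c L}
    (hP : Tendsto (fun h => (P h).modulus) atTop (𝓝 0)) {M : ℝ≥0}
    (hM : liminf (fun h => (P h).pRotation p) atTop < M) :
    ∃ τ w : ℝ → E, IsTangent p L c τ w ∧ ∫⁻ s in Ioo 0 L, ‖w s‖ₑ ^ p ≤ M := by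
  obtain ⟨φ, hφ, hφM⟩ := extraction_of_frequently_atTop
    (frequently_lt_of_liminf_lt isCobounded_ge_of_top hM)
  obtain ⟨τ, w, h1, h2⟩ := exists_isTangent hL hp M.2 hc (P := fun n => P (φ n))
    (hP.comp hφ.tendsto_atTop) fun n => by
      have := (hφM n).le
      rwa [← ENNReal.ofReal_coe_nnreal] at this
  exact ⟨τ, w, h1, by rwa [← ENNReal.ofReal_coe_nnreal]⟩

theorem exists_isTangent_of_pCurvature_lt (hp : 1 < p) (hL : 0 < L)
    (hc : HasUnitSpeedOn c (Icc 0 L)) {M : ℝ≥0} (hM : pCurvature p L c < M) :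
    ∃ τ w : ℝ → E, IsTangent p L c τ w ∧ ∫⁻ s in Ioo 0 L, ‖w s‖ₑ ^ p ≤ M := by
  obtain ⟨P, hP⟩ := iInf_lt_iff.1 hM
  obtain ⟨hPm, hPM⟩ := iInf_lt_iff.1 hP
  exact exists_isTangent_of_liminf_lt hp hL hc hPm hPM

theorem IsTangent.pCurvature_eq (h : IsTangent p L c τ w) (hp : 1 < p) (hL : 0 < L)
    (hc : HasUnitSpeedOn c (Icc 0 L)) :
    pCurvature p L c = ∫⁻ s in Ioo 0 L, ‖w s‖ₑ ^ p := by
  refine le_antisymm (h.pCurvature_le hp hL hc) (not_lt.1 fun hlt => ?_)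
  -- A p-curvature below `M` produces a tangent with energy at most `M`; by uniqueness of weak
  -- derivatives this is the energy of `w`, which exceeds `M`.
  obtain ⟨M, hM1, hM2⟩ := ENNReal.lt_iff_exists_nnreal_btwn.1 hlt
  obtain ⟨τ', w', h', hle⟩ := exists_isTangent_of_pCurvature_lt hp hL hc hM1
  rw [h'.lintegral_eq hp hL (h.isWeakDeriv_tangent hp hL) (h.isWeakDeriv_curvature hp hL)] at hle
  exact absurd hle (not_le.2 hM2)

theorem pCurvature_lt_top_iff (hp : 1 < p) (hL : 0 < L) (hc : HasUnitSpeedOn c (Icc 0 L)) :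
    pCurvature p L c < ∞ ↔ ∃ τ w : ℝ → E, IsTangent p L c τ w := by
  constructor
  · intro h
    obtain ⟨M, hM, -⟩ := ENNReal.lt_iff_exists_nnreal_btwn.1 h
    obtain ⟨τ, w, h', -⟩ := exists_isTangent_of_pCurvature_lt hp hL hc hM
    exact ⟨τ, w, h'⟩
  · rintro ⟨τ, w, h⟩
    exact (h.pCurvature_le hp hL hc).trans_lt ((memLp_iff_lintegral hp).1 h.memLp).2

end Curvature

end ElasticCurve

theorem mainTheorem2 (N : ℕ) (hN : 1 ≤ N) (p : ℝ) (hp : 1 < p) (L : ℝ) (hL : 0 < L)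
    (c : ℝ → EuclideanSpace ℝ (Fin (N + 1)))
    (harc : HasUnitSpeedOn c (Icc 0 L)) (hclosed : c 0 = c L) :
    (ElasticCurve.pCurvature p L c < ∞ ↔
      ElasticCurve.MemW2 p 0 L c ∧
        ∃ τ : EuclideanSpace ℝ (Fin (N + 1)),
          HasDerivWithinAt c τ (Icc 0 L) 0 ∧ HasDerivWithinAt c τ (Icc 0 L) L) ∧
    (ElasticCurve.pCurvature p L c < ∞ →
      ∀ v w : ℝ → EuclideanSpace ℝ (Fin (N + 1)),
        ElasticCurve.IsWeakDeriv 0 L c v → ElasticCurve.IsWeakDeriv 0 L v w →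
          ElasticCurve.pCurvature p L c = ∫⁻ s in Ioo 0 L, ‖w s‖ₑ ^ p) := by
  rw [ElasticCurve.pCurvature_lt_top_iff hp hL harc]
  refine ⟨⟨?_, ?_⟩, ?_⟩
  · rintro ⟨τ, w, h⟩
    refine ⟨h.memW2 hp hL, τ 0, h.hasDeriv 0 (left_mem_Icc.2 hL.le), ?_⟩
    rw [h.closed]
    exact h.hasDeriv L (right_mem_Icc.2 hL.le)
  · rintro ⟨hW, e, h0, h1⟩
    exact hW.exists_isTangent hp hL
      (ElasticCurve.lipschitzOnWith_of_unitSpeed harc).continuousOn h0 h1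
  · rintro ⟨τ, w', h⟩ v w hv hw
    rw [h.pCurvature_eq hp hL harc, h.lintegral_eq hp hL hv hw]
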